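/- Let $(X,\|\cdot\|)$ be a real Banach space, let $F\subseteq X^*$ be a linear subspace (not necessarily closed), and let $|||\cdot|||$ be a norm on $X$ that is coarser than $\|\cdot\|$ (that is, $|||x|||\le C\|x\|$ for all $x\in X$ and some constant $C$), such that $F\cap (X,|||\cdot|||)^*$ separates the points of $X$. Let $\sigma(X,F)$ denote the coarsest topology on $X$ making every $f\in F$ continuous. A topological space $T$ is called a Gruenhage space if there are families $(\mathscr U_n)_{n\in\mathbb N}$ of open subsets of $T$ such that for any distinct $x,y\in T$ there exist $n\in\mathbb N$ and $U\in\mathscr U_n$ such that $U\cap\{x,y\}$ is a singleton and either $x$ lies in only finitely many members of $\mathscr U_n$ or $y$ lies in only finitely many members of $\mathscr U_n$. Let $K\subseteq X$ be $\sigma(X,F)$-compact and a Gruenhage space in its $\sigma(X,F)$-subspace topology, and suppose that $X=\overline{\mathrm{span}}^{\,|||\cdot|||}(K)$. Call a norm $\nu$ on $X$ strictly convex if $\nu(x)=\nu(y)=\tfrac12\nu(x+y)$ implies $x=y$. Then: 1. there is a norm $|\cdot|$ on $X$ that is coarser than $\|\cdot\|$, $\sigma(X,F)$-lower semicontinuous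 and strictly convex, and that is moreover equivalent to $\|\cdot\|$ if $F$ is norming, i.e. if there is $c>0$ with $\sup\{f(x): f\in F,\ \|f\|\le 1\}\ge c\|x\|$ for all $x\in X$; 2. $X$ admits a strictly convex norm equivalent to $\|\cdot\|$. -/

import Mathlib

/-- The evaluation pairing `X × F → ℝ`, `(x, f) ↦ f x`, of a real normed space with a subspace `F`
of its topological dual. -/
def evalPairing {X : Type*} [NormedAddCommGroup X] [NormedSpace ℝ X]
    (F : Submodule ℝ (StrongDual ℝ X)) : X →ₗ[ℝ] F →ₗ[ℝ] ℝ :=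
  LinearMap.mk₂ ℝ (fun (x : X) (f : F) => (f : StrongDual ℝ X) x)
    (fun _ _ _ => by simp) (fun _ _ _ => by simp) (fun _ _ _ => by simp) (fun _ _ _ => by simp)

/-- The topology `σ(X, F)` on `X`: the coarsest topology for which every `f ∈ F` is continuous. -/
@[reducible]
def sigmaTopology {X : Type*} [NormedAddCommGroup X] [NormedSpace ℝ X]
    (F : Submodule ℝ (StrongDual ℝ X)) : TopologicalSpace X :=
  inferInstanceAs (TopologicalSpace (WeakBilin (evalPairing F)))

/-- A Gruenhage space: there are countably many families `U n` of open sets such that any two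
distinct points `x, y` are separated by a member of some `U n` for which `x` lies in only finitely
many members of `U n`, or `y` does. -/
def IsGruenhageSpace (T : Type*) [TopologicalSpace T] : Prop :=
  ∃ U : ℕ → Set (Set T), (∀ n, ∀ V ∈ U n, IsOpen V) ∧
    ∀ x y : T, x ≠ y → ∃ n, ∃ V ∈ U n,
      (∃ z, V ∩ {x, y} = {z}) ∧
      ({W ∈ U n | x ∈ W}.Finite ∨ {W ∈ U n | y ∈ W}.Finite)

/-- A subset of a (Hausdorff) topological space is a Gruenhage compact if it is compact and is a
Gruenhage space in its subspace topology. -/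
def IsGruenhageCompact {T : Type*} [TopologicalSpace T] (K : Set T) : Prop :=
  IsCompact K ∧ IsGruenhageSpace K

section Norms

variable {X : Type*} [NormedAddCommGroup X] [NormedSpace ℝ X]

/-- A seminorm that is a norm. -/
def IsNorm (p : Seminorm ℝ X) : Prop :=
  ∀ x, p x = 0 → x = 0

/-- `p` is coarser than the given norm of `X`. -/
def IsCoarserThanNorm (p : Seminorm ℝ X) : Prop :=
  ∃ C : ℝ, ∀ x, p x ≤ C * ‖x‖

/-- `p` is equivalent to the given norm of `X`. -/
def IsEquivalentToNorm (p : Seminorm ℝ X) : Prop :=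
  ∃ c C : ℝ, 0 < c ∧ ∀ x, c * ‖x‖ ≤ p x ∧ p x ≤ C * ‖x‖

/-- Strict convexity (rotundity) of a norm `p`. -/
def IsStrictlyConvexNorm (p : Seminorm ℝ X) : Prop :=
  ∀ x y, p x = p y → p y = (1 / 2 : ℝ) * p (x + y) → x = y

/-- The subspace `F ∩ (X, p)*` separates the points of `X`. The functionals in `(X, p)*` are those
that are bounded with respect to `p`. -/
def SeparatesWithBounded (F : Submodule ℝ (StrongDual ℝ X)) (p : Seminorm ℝ X) : Prop :=
  ∀ x y : X, x ≠ y → ∃ f ∈ F, (∃ C : ℝ, ∀ z, |f z| ≤ C * p z) ∧ f x ≠ f y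

/-- `X` is the `p`-closure of the linear span of `K`. -/
def IsClosedSpan (p : Seminorm ℝ X) (K : Set X) : Prop :=
  ∀ x : X, ∀ ε > 0, ∃ y ∈ Submodule.span ℝ K, p (x - y) < ε

/-- `F` is a norming subspace of the dual: `x ↦ sup {f x | f ∈ F, ‖f‖ ≤ 1}` dominates a positive
multiple of the norm (it never exceeds the norm). -/
def IsNormingSubspace (F : Submodule ℝ (StrongDual ℝ X)) : Prop :=
  ∃ c : ℝ, 0 < c ∧ ∀ x : X, c * ‖x‖ ≤ sSup {r : ℝ | ∃ f ∈ F, ‖f‖ ≤ 1 ∧ r = f x}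

end Norms

open MeasureTheory Set Topology
open scoped ENNReal

/-! Strict convexity is first produced on the positive cone of the dual of `C(K)` and then pulled
back to `X`.

A Gruenhage structure yields countably many sunflowers: for each of its families and each k, the
points lying in exactly k members split into disjoint pieces according to which members these are.
Closing up under finite intersections gives a point-separating π-system of pieces. A finite regular
measure on `K` is determined by its values on them (`measure_ext_of_pieces`): each sunflower has
only countably many non-null pieces, its null pieces have null union, and on compact sets of almost
full measure the remaining countably many pieces are clopen and separate points.

For one sunflower, the mass of the core plus the n largest masses of pieces is a supremum of
integrals of continuous functions, hence weak* lower semicontinuous. If these suprema agree for μ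
and ν and are additive at μ + ν for all n, then μ and ν agree on all its pieces (`eq_of_topSum_eq`,
`exists_testSets_of_isGruenhageSpace`).

For the transfer, a vector x is represented by two positive functionals on `C(K)`, their difference
matching x up to an error r on every functional in `F` dominated by |||·|||. The cost is an ℓ²
combination of r and of 1/(n+1) times the suprema above, and `p n x` is the least cost. Weak*
compactness makes it attained and lower semicontinuous. In the equality case for x and y the
minimizers carry the same functionals, so each admissible functional separates x and y by at most
2r. Density of the span makes `p n x` tend to 0, whence x = y (`exists_transfer_seminorms`).

An ℓ² combination of the `p n` and of the supremum over the unit ball of `F` is the first norm;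
combining it with ‖·‖ gives the second. -/

/-- A family of open sets (the petals) any two of which meet only inside a common open core. -/
structure OpenSunflower (T : Type*) [TopologicalSpace T] where
  petals : Set (Set T)
  core : Set T
  isOpen_core : IsOpen core
  isOpen_petal : ∀ v ∈ petals, IsOpen v
  inter_subset : ∀ v ∈ petals, ∀ w ∈ petals, v ≠ w → v ∩ w ⊆ core

/-! ### Sunflowers and the π-system of their pieces -/

namespace OpenSunflower

variable {T : Type*} [TopologicalSpace T]

/-- The sunflower whose only petal is `V` and whose core is empty. -/
def single (V : Set T) (hV : IsOpen V) : OpenSunflower T where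
  petals := {V}
  core := ∅
  isOpen_core := isOpen_empty
  isOpen_petal := by rintro v rfl; exact hV
  inter_subset := by rintro v rfl w rfl h; exact absurd rfl h

/-- The sunflower whose petals, up to the core, are the intersections of petals of two given
sunflowers. -/
def meet (S S' : OpenSunflower T) : OpenSunflower T where
  petals := image2 (fun v w => (v ∩ w) ∪ (S.core ∪ S'.core)) S.petals S'.petals
  core := S.core ∪ S'.core
  isOpen_core := S.isOpen_core.union S'.isOpen_core
  isOpen_petal := by
    rintro _ ⟨v, hv, w, hw, rfl⟩
    exact ((S.isOpen_petal v hv).inter (S'.isOpen_petal w hw)).union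
      (S.isOpen_core.union S'.isOpen_core)
  inter_subset := by
    rintro _ ⟨v, hv, w, hw, rfl⟩ _ ⟨v', hv', w', hw', rfl⟩ hne x ⟨hx, hx'⟩
    rcases hx with hx | hx
    · rcases hx' with hx' | hx'
      · by_cases h : v = v'
        · have h' : w ≠ w' := by rintro rfl; subst h; exact hne rfl
          exact Or.inr (S'.inter_subset w hw w' hw' h' ⟨hx.2, hx'.2⟩)
        · exact Or.inl (S.inter_subset v hv v' hv' h ⟨hx.1, hx'.1⟩)
      · exact hx'
    · exact hx

/-- The sets obtained from petals by removing the core. -/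
def pieces (S : OpenSunflower T) : Set (Set T) := (fun v => v \ S.core) '' S.petals

lemma pieces_single (V : Set T) (hV : IsOpen V) : (single V hV).pieces = {V} := by
  simp [pieces, single]

/-- Removing the joint core from v ∩ w leaves (v minus its core) ∩ (w minus its core). Meets of
sunflowers thus realize intersections of pieces, which is what makes a π-system possible. -/
lemma pieces_meet (S S' : OpenSunflower T) :
    (S.meet S').pieces = image2 (fun v w => v ∩ w) S.pieces S'.pieces := by
  ext s
  simp only [pieces, meet, mem_image, mem_image2, exists_exists_and_eq_and,
    exists_exists_and_exists_and_eq_and]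
  constructor
  · rintro ⟨v, hv, w, hw, rfl⟩
    refine ⟨v, hv, w, hw, ?_⟩
    ext x; simp only [mem_inter_iff, mem_sdiff, mem_union]; tauto
  · rintro ⟨v, hv, w, hw, rfl⟩
    refine ⟨v, hv, w, hw, ?_⟩
    ext x; simp only [mem_inter_iff, mem_sdiff, mem_union]; tauto

/-- The iterated meet of a list of sunflowers. -/
def listMeet : List (OpenSunflower T) → OpenSunflower T
  | [] => single univ isOpen_univ
  | S :: l => S.meet (listMeet l)

lemma inter_mem_pieces_listMeet (l l' : List (OpenSunflower T)) {s s' : Set T}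
    (hs : s ∈ (listMeet l).pieces) (hs' : s' ∈ (listMeet l').pieces) :
    s ∩ s' ∈ (listMeet (l ++ l')).pieces := by
  induction l generalizing s with
  | nil =>
    rw [listMeet, pieces_single] at hs
    rw [mem_singleton_iff.1 hs, univ_inter]
    exact hs'
  | cons S l ih =>
    rw [listMeet, pieces_meet] at hs
    obtain ⟨v, hv, w, hw, rfl⟩ := hs
    rw [List.cons_append, listMeet, pieces_meet, inter_assoc]
    exact ⟨v, hv, _, ih hw, rfl⟩

lemma pieces_listMeet_singleton (S : OpenSunflower T) : (listMeet [S]).pieces = S.pieces := by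
  rw [listMeet, pieces_meet, listMeet, pieces_single]
  simp

/-! ### Sunflowers obtained from the multiplicity of a family of open sets -/

section Multiplicity

variable (𝒰 : Set (Set T))

/-- The points that lie in at least `k` members of `𝒰`. -/
def multiplicityGE (k : ℕ) : Set T :=
  {x | ∃ F : Finset (Set T), ↑F ⊆ 𝒰 ∧ F.card = k ∧ ∀ u ∈ F, x ∈ u}

variable {𝒰}

lemma isOpen_multiplicityGE (h : ∀ u ∈ 𝒰, IsOpen u) (k : ℕ) : IsOpen (multiplicityGE 𝒰 k) := by
  have : multiplicityGE 𝒰 k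
      = ⋃ F : {F : Finset (Set T) // ↑F ⊆ 𝒰 ∧ F.card = k}, ⋂ u ∈ F.1, u := by
    ext x
    simp [multiplicityGE, and_assoc]
  rw [this]
  exact isOpen_iUnion fun F => isOpen_biInter_finset fun u hu => h u (F.2.1 hu)

/-- The sunflower whose petals are, up to the core, the intersections of `k` members of `𝒰`, the
core being the set of points lying in more than `k` members. -/
def ofMultiplicity (h : ∀ u ∈ 𝒰, IsOpen u) (k : ℕ) : OpenSunflower T where
  petals := (fun F : Finset (Set T) => (⋂ u ∈ F, u) ∪ multiplicityGE 𝒰 (k + 1)) ''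
    {F : Finset (Set T) | ↑F ⊆ 𝒰 ∧ F.card = k}
  core := multiplicityGE 𝒰 (k + 1)
  isOpen_core := isOpen_multiplicityGE h _
  isOpen_petal := by
    rintro _ ⟨F, hF, rfl⟩
    exact (isOpen_biInter_finset fun u hu => h u (hF.1 hu)).union (isOpen_multiplicityGE h _)
  inter_subset := by
    classical
    rintro _ ⟨F, hF, rfl⟩ _ ⟨G, hG, rfl⟩ hne x ⟨hx, hx'⟩
    rcases hx with hx | hx
    · rcases hx' with hx' | hx'
      · have hFG : F ≠ G := by rintro rfl; exact hne rfl
        -- Two distinct sets of k members have at least k + 1 members together, so a point common to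
        -- both intersections is in the core.
        have hcard : k + 1 ≤ (F ∪ G).card := by
          by_contra hlt
          have h1 : F = F ∪ G := Finset.eq_of_subset_of_card_le Finset.subset_union_left
            (by have := hF.2; omega)
          have h2 : G = F ∪ G := Finset.eq_of_subset_of_card_le Finset.subset_union_right
            (by have := hG.2; omega)
          exact hFG (h1.trans h2.symm)
        obtain ⟨H, hH, hHc⟩ := Finset.exists_subset_card_eq hcard
        refine ⟨H, fun u hu => ?_, hHc, fun u hu => ?_⟩
        · rcases Finset.mem_union.1 (hH hu) with hu | hu
          exacts [hF.1 hu, hG.1 hu]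
        · rcases Finset.mem_union.1 (hH hu) with hu | hu
          exacts [mem_iInter₂.1 hx u hu, mem_iInter₂.1 hx' u hu]
      · exact hx'
    · exact hx

/-- If `x` lies in finitely many members of `𝒰` and some member of `𝒰` contains exactly one of `x`
and `y`, then a piece of one of the associated sunflowers, or one of their cores, does as well. -/
lemma exists_separating (h : ∀ u ∈ 𝒰, IsOpen u) {x y : T} (hx : {u ∈ 𝒰 | x ∈ u}.Finite)
    {v : Set T} (hv : v ∈ 𝒰) (hxy : ¬ (x ∈ v ↔ y ∈ v)) :
    ∃ k, (∃ s ∈ (ofMultiplicity h k).pieces, ¬ (x ∈ s ↔ y ∈ s)) ∨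
      ¬ (x ∈ (ofMultiplicity h k).core ↔ y ∈ (ofMultiplicity h k).core) := by
  classical
  set F := hx.toFinset with hF
  have memF : ∀ u, u ∈ F ↔ u ∈ 𝒰 ∧ x ∈ u := fun u => by simp [hF]
  have hxcore : x ∉ multiplicityGE 𝒰 (F.card + 1) := by
    rintro ⟨G, hG, hGc, hGx⟩
    have := Finset.card_le_card (fun u hu => (memF u).2 ⟨hG hu, hGx u hu⟩ : G ⊆ F)
    omega
  -- For k the exact multiplicity of x, the point x avoids the core and its piece consists of the
  -- points lying in exactly the same members as x.
  refine ⟨F.card, ?_⟩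
  by_cases hycore : y ∈ multiplicityGE 𝒰 (F.card + 1)
  · exact Or.inr fun hiff => hxcore (hiff.2 hycore)
  · left
    refine ⟨_, ⟨_, ⟨F, ⟨fun u hu => ((memF u).1 hu).1, rfl⟩, rfl⟩, rfl⟩, fun hiff => ?_⟩
    have hxs : x ∈ (⋂ u ∈ F, u) ∪ multiplicityGE 𝒰 (F.card + 1) :=
      Or.inl (mem_iInter₂.2 fun u hu => ((memF u).1 hu).2)
    have hy := (hiff.1 ⟨hxs, hxcore⟩).1
    rcases hy with hy | hy
    · by_cases hxv : x ∈ v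
      · exact hxy ⟨fun _ => mem_iInter₂.1 hy v ((memF v).2 ⟨hv, hxv⟩), fun _ => hxv⟩
      · have hyv : y ∈ v := by tauto
        refine hycore ⟨insert v F, ?_, ?_, ?_⟩
        · intro u hu
          rcases Finset.mem_insert.1 hu with rfl | hu
          exacts [hv, ((memF u).1 hu).1]
        · exact Finset.card_insert_of_notMem fun hvF => hxv ((memF v).1 hvF).2
        · intro u hu
          rcases Finset.mem_insert.1 hu with rfl | hu
          exacts [hyv, mem_iInter₂.1 hy u hu]
    · exact hycore hy

end Multiplicity

/-- A Gruenhage space carries countably many open sunflowers whose pieces form a point-separating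
`π`-system. -/
theorem exists_of_isGruenhageSpace (hT : IsGruenhageSpace T) :
    ∃ (ι : Type) (_ : Countable ι) (S : ι → OpenSunflower T),
      IsPiSystem (⋃ i, (S i).pieces) ∧ univ ∈ ⋃ i, (S i).pieces ∧
      ∀ x y, x ≠ y → ∃ s ∈ ⋃ i, (S i).pieces, ¬ (x ∈ s ↔ y ∈ s) := by
  obtain ⟨U, hU, hsep⟩ := hT
  -- Cores may be what separates two points, so each core is also entered as the only piece of a
  -- sunflower of its own.
  let S₀ : ℕ × ℕ × Bool → OpenSunflower T := fun j =>
    bif j.2.2 then ofMultiplicity (hU j.1) j.2.1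
    else single (ofMultiplicity (hU j.1) j.2.1).core (isOpen_core _)
  -- Finite lists are countable in number; concatenation gives closure under intersection and the
  -- empty list gives `univ`.
  refine ⟨List (ℕ × ℕ × Bool), inferInstance, fun l => listMeet (l.map S₀), ?_, ?_, ?_⟩
  · intro s hs s' hs' _
    obtain ⟨l, hl⟩ := mem_iUnion.1 hs
    obtain ⟨l', hl'⟩ := mem_iUnion.1 hs'
    refine mem_iUnion.2 ⟨l ++ l', ?_⟩
    show _ ∈ (listMeet ((l ++ l').map S₀)).pieces
    rw [List.map_append]
    exact inter_mem_pieces_listMeet _ _ hl hl'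
  · refine mem_iUnion.2 ⟨[], ?_⟩
    simp [listMeet, pieces_single]
  · have key : ∀ x y n v, v ∈ U n → {W ∈ U n | x ∈ W}.Finite → ¬ (x ∈ v ↔ y ∈ v) →
        ∃ s ∈ ⋃ l : List (ℕ × ℕ × Bool), (listMeet (l.map S₀)).pieces, ¬ (x ∈ s ↔ y ∈ s) := by
      intro x y n v hv hfin hxy
      obtain ⟨k, ⟨s, hs, hsxy⟩ | hcore⟩ := exists_separating (hU n) hfin hv hxy
      · refine ⟨s, mem_iUnion.2 ⟨[(n, k, true)], ?_⟩, hsxy⟩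
        rw [List.map_singleton, pieces_listMeet_singleton]
        exact hs
      · refine ⟨_, mem_iUnion.2 ⟨[(n, k, false)], ?_⟩, hcore⟩
        rw [List.map_singleton, pieces_listMeet_singleton]
        exact (pieces_single _ (isOpen_core (ofMultiplicity (hU n) k))).symm ▸ mem_singleton _
    intro x y hxy
    obtain ⟨n, v, hv, ⟨z, hz⟩, hfin⟩ := hsep x y hxy
    have hv' : ¬ (x ∈ v ↔ y ∈ v) := by
      intro hiff
      have hzm : z ∈ v ∩ {x, y} := hz ▸ mem_singleton z
      have hxv : x ∈ v := by
        rcases hzm.2 with rfl | h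
        · exact hzm.1
        · exact hiff.2 (mem_singleton_iff.1 h ▸ hzm.1)
      have h1 : x ∈ ({z} : Set T) := hz ▸ ⟨hxv, by simp⟩
      have h2 : y ∈ ({z} : Set T) := hz ▸ ⟨hiff.1 hxv, by simp⟩
      exact hxy (h1.trans h2.symm)
    rcases hfin with hfin | hfin
    · exact key x y n v hv hfin hv'
    · obtain ⟨s, hs, h⟩ := key y x n v hv hfin fun h => hv' h.symm
      exact ⟨s, hs, fun h' => h h'.symm⟩

/-- Indexing is by petals because distinct petals may leave the same, then empty, piece. -/
lemma pairwiseDisjoint_pieces (S : OpenSunflower T) :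
    S.petals.PairwiseDisjoint fun v => v \ S.core := by
  intro v hv w hw hne
  refine disjoint_left.2 fun x hx hx' => hx.2 (S.inter_subset v hv w hw hne ⟨hx.1, hx'.1⟩)

end OpenSunflower

/-! ### Null and non-null pieces for a finite measure -/

namespace OpenSunflower

variable {K : Type*} [TopologicalSpace K] [MeasurableSpace K] [BorelSpace K]

lemma measurableSet_of_mem_pieces (S : OpenSunflower K) {s : Set K} (hs : s ∈ S.pieces) :
    MeasurableSet s := by
  obtain ⟨v, hv, rfl⟩ := hs
  exact (S.isOpen_petal v hv).measurableSet.diff S.isOpen_core.measurableSet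

/-- The union of the null pieces of a sunflower is a null set. -/
lemma measure_sUnion_null_pieces [T2Space K] (S : OpenSunflower K) (m : Measure K)
    [IsFiniteMeasure m] [m.InnerRegular] :
    MeasurableSet (⋃₀ {s ∈ S.pieces | m s = 0}) ∧ m (⋃₀ {s ∈ S.pieces | m s = 0}) = 0 := by
  set O := ⋃₀ {v ∈ S.petals | m (v \ S.core) = 0} with hO
  have hOopen : IsOpen O := isOpen_sUnion fun v hv => S.isOpen_petal v hv.1
  have heq : ⋃₀ {s ∈ S.pieces | m s = 0} = O \ S.core := by
    ext x
    constructor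
    · rintro ⟨_, ⟨⟨v, hv, rfl⟩, h0⟩, hx⟩
      exact ⟨⟨v, ⟨hv, h0⟩, hx.1⟩, hx.2⟩
    · rintro ⟨⟨v, ⟨hv, h0⟩, hx⟩, hx'⟩
      exact ⟨_, ⟨⟨v, hv, rfl⟩, h0⟩, hx, hx'⟩
  have hmeas : MeasurableSet (O \ S.core) :=
    hOopen.measurableSet.diff S.isOpen_core.measurableSet
  rw [heq]
  refine ⟨hmeas, ?_⟩
  -- The union may be uncountable. Inner regularity reduces to compact subsets, on which being null
  -- is a local property; there each petal meets the compact set in a null set because the core has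
  -- been removed.
  rw [hmeas.measure_eq_iSup_isCompact]
  simp only [ENNReal.iSup_eq_zero]
  intro C hC hCc
  refine hCc.measure_zero_of_nhdsWithin fun x hx => ?_
  obtain ⟨v, hv, hxv⟩ := (hC hx).1
  refine ⟨v ∩ C, Filter.inter_mem (mem_nhdsWithin_of_mem_nhds ((S.isOpen_petal v hv.1).mem_nhds hxv))
    self_mem_nhdsWithin, ?_⟩
  have hsub : v ∩ C ⊆ v \ S.core := fun y hy => ⟨hy.1, (hC hy.2).2⟩
  exact measure_mono_null hsub hv.2

lemma countable_nonnull_pieces (S : OpenSunflower K) (m : Measure K) [IsFiniteMeasure m] :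
    {s ∈ S.pieces | m s ≠ 0}.Countable := by
  have h := Measure.countable_meas_pos_of_disjoint_iUnion (μ := m)
    (As := fun v : S.petals => (v : Set K) \ S.core)
    (fun v => S.measurableSet_of_mem_pieces ⟨v, v.2, rfl⟩)
    (fun v w hvw => S.pairwiseDisjoint_pieces v.2 w.2 fun h => hvw (Subtype.ext h))
  refine (h.image fun v : S.petals => (v : Set K) \ S.core).mono ?_
  rintro _ ⟨⟨v, hv, rfl⟩, h0⟩
  exact ⟨⟨v, hv⟩, pos_iff_ne_zero.2 h0, rfl⟩

end OpenSunflower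

/-! ### Finite regular measures are determined by the pieces -/

section Determination

variable {K : Type*} [TopologicalSpace K] [T2Space K] [MeasurableSpace K] [BorelSpace K]

/-- Given a countable family of measurable sets, there are compact sets of almost full measure on
which every member of the family is relatively clopen. -/
lemma exists_isCompact_continuous_decide [CompactSpace K] (m : Measure K) [IsFiniteMeasure m]
    [m.InnerRegular] {𝒞 : Set (Set K)} (h𝒞 : 𝒞.Countable) (hm : ∀ s ∈ 𝒞, MeasurableSet s)
    {N : Set K} (hN : MeasurableSet N) (hN0 : m N = 0) {ε : ℝ≥0∞} (hε : ε ≠ 0) :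
    ∃ L : Set K, IsCompact L ∧ Disjoint L N ∧ m Lᶜ ≤ ε ∧
      ∀ s ∈ 𝒞, IsClopen ((↑) ⁻¹' s : Set L) := by
  have := h𝒞.to_subtype
  -- One third each pays for the sets `P s`, the sets `Q s` and `L₀`.
  have hε3 : ε / 3 ≠ 0 := (ENNReal.div_pos hε (by simp)).ne'
  obtain ⟨e, he, hes⟩ := ENNReal.exists_pos_sum_of_countable' hε3 𝒞
  choose P hPs hPc hP using fun s : 𝒞 =>
    (hm s s.2).exists_isCompact_sdiff_lt (measure_ne_top m _) (he s).ne'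
  choose Q hQs hQc hQ using fun s : 𝒞 =>
    (hm s s.2).compl.exists_isCompact_sdiff_lt (measure_ne_top m _) (he s).ne'
  obtain ⟨L₀, hL₀N, hL₀c, hL₀⟩ :=
    hN.compl.exists_isCompact_sdiff_lt (measure_ne_top m _) hε3
  refine ⟨L₀ ∩ ⋂ s : 𝒞, (P s ∪ Q s), ?_, ?_, ?_, ?_⟩
  · exact hL₀c.inter_right (isClosed_iInter fun s => (hPc s).isClosed.union (hQc s).isClosed)
  · exact disjoint_left.2 fun x hx hxN => hL₀N hx.1 hxN
  · have hsub : (L₀ ∩ ⋂ s : 𝒞, (P s ∪ Q s))ᶜ ⊆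
        (N ∪ (Nᶜ \ L₀)) ∪ ((⋃ s : 𝒞, ((s : Set K) \ P s)) ∪ ⋃ s : 𝒞, ((s : Set K)ᶜ \ Q s)) := by
      intro x hx
      simp only [mem_compl_iff, mem_inter_iff, mem_iInter, mem_union, mem_iUnion, mem_sdiff,
        not_and_or, not_forall, not_or] at hx ⊢
      rcases hx with hx | ⟨s, hx⟩
      · left; tauto
      · right
        by_cases hxs : x ∈ (s : Set K)
        · exact Or.inl ⟨s, hxs, hx.1⟩
        · exact Or.inr ⟨s, hxs, hx.2⟩
    calc m _ ≤ m ((N ∪ (Nᶜ \ L₀)) ∪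
          ((⋃ s : 𝒞, ((s : Set K) \ P s)) ∪ ⋃ s : 𝒞, ((s : Set K)ᶜ \ Q s))) := measure_mono hsub
      _ ≤ (m N + m (Nᶜ \ L₀)) + (∑' s : 𝒞, m ((s : Set K) \ P s) + ∑' s : 𝒞, m ((s : Set K)ᶜ \ Q s)) := by
          refine (measure_union_le _ _).trans (add_le_add (measure_union_le _ _) ?_)
          exact (measure_union_le _ _).trans
            (add_le_add (measure_iUnion_le _) (measure_iUnion_le _))
      _ ≤ (0 + ε / 3) + (ε / 3 + ε / 3) := by
          gcongr
          · exact hN0.le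
          · exact (ENNReal.tsum_le_tsum fun s => (hP s).le).trans hes.le
          · exact (ENNReal.tsum_le_tsum fun s => (hQ s).le).trans hes.le
      _ = ε := by rw [zero_add, ← add_assoc, ENNReal.add_thirds]
  · intro s hs
    set L := L₀ ∩ ⋂ s : 𝒞, (P s ∪ Q s) with hL
    -- Within `L`, the set s is the trace of the compact set `P` and its complement that of `Q`, so
    -- both are closed.
    have hPL : ((↑) ⁻¹' s : Set L) = (↑) ⁻¹' (P ⟨s, hs⟩) := by
      ext x
      refine ⟨fun hx => ?_, fun hx => hPs ⟨s, hs⟩ hx⟩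
      exact (mem_iInter.1 x.2.2 ⟨s, hs⟩).resolve_right fun h => hQs ⟨s, hs⟩ h hx
    have hQL : ((↑) ⁻¹' s : Set L)ᶜ = (↑) ⁻¹' (Q ⟨s, hs⟩) := by
      ext x
      refine ⟨fun hx => ?_, fun hx => hQs ⟨s, hs⟩ hx⟩
      exact (mem_iInter.1 x.2.2 ⟨s, hs⟩).resolve_left fun h => hx (hPs ⟨s, hs⟩ h)
    refine ⟨hPL ▸ (hPc _).isClosed.preimage continuous_subtype_val, ?_⟩
    rw [← isClosed_compl_iff, hQL]
    exact (hQc _).isClosed.preimage continuous_subtype_val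

/-- Two finite regular measures on a compact space coincide if they agree on all pieces of a
countable collection of sunflowers whose pieces form a point-separating `π`-system. -/
theorem measure_ext_of_pieces [CompactSpace K] {ι : Type*} [Countable ι] {S : ι → OpenSunflower K}
    (hpi : IsPiSystem (⋃ i, (S i).pieces)) (huniv : univ ∈ ⋃ i, (S i).pieces)
    (hsep : ∀ x y, x ≠ y → ∃ s ∈ ⋃ i, (S i).pieces, ¬ (x ∈ s ↔ y ∈ s))
    {μ ν : Measure K} [IsFiniteMeasure μ] [IsFiniteMeasure ν] [μ.Regular] [ν.Regular]
    (h : ∀ s ∈ ⋃ i, (S i).pieces, μ s = ν s) : μ = ν := by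
  classical
  set 𝒮 := ⋃ i, (S i).pieces with h𝒮
  set m := μ + ν with hmdef
  have hm𝒮 : ∀ s ∈ 𝒮, MeasurableSet s := fun s hs => by
    obtain ⟨i, hi⟩ := mem_iUnion.1 hs
    exact (S i).measurableSet_of_mem_pieces hi
  -- This σ-algebra may be smaller than the Borel one, so closed sets still have to be approximated
  -- by its members.
  have hgen : ∀ s, MeasurableSet[MeasurableSpace.generateFrom 𝒮] s → μ s = ν s := fun s hs =>
    ext_on_measurableSpace_of_generate_finite _ 𝒮 h (MeasurableSpace.generateFrom_le hm𝒮) rfl hpi (h _ huniv) hs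
  set 𝒞 := ⋃ i, {s ∈ (S i).pieces | m s ≠ 0} with h𝒞
  have h𝒞𝒮 : 𝒞 ⊆ 𝒮 := iUnion_mono fun i s hs => hs.1
  have h𝒞c : 𝒞.Countable := countable_iUnion fun i => (S i).countable_nonnull_pieces m
  set N := ⋃ i, ⋃₀ {s ∈ (S i).pieces | m s = 0} with hN
  have hNm : MeasurableSet N :=
    MeasurableSet.iUnion fun i => ((S i).measure_sUnion_null_pieces m).1
  have hN0 : m N = 0 := measure_iUnion_null fun i => ((S i).measure_sUnion_null_pieces m).2
  have := h𝒞c.to_subtype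
  let Φ : K → 𝒞 → Bool := fun x s => decide (x ∈ (s : Set K))
  have hΦ : Measurable[MeasurableSpace.generateFrom 𝒮] Φ := by
    refine @measurable_pi_lambda _ _ _ (MeasurableSpace.generateFrom 𝒮) _ _ fun s => ?_
    refine @measurable_to_bool _ (MeasurableSpace.generateFrom 𝒮) _ ?_
    have : (fun x => Φ x s) ⁻¹' {true} = s := by ext x; simp [Φ]
    rw [this]
    exact MeasurableSpace.measurableSet_generateFrom (h𝒞𝒮 s.2)
  have key : ∀ A : Set K, IsClosed A → ∀ ε : ℝ≥0∞, ε ≠ 0 → ∃ B, μ B = ν B ∧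
      m (A \ B) ≤ ε ∧ m (B \ A) ≤ ε := by
    intro A hA ε hε
    obtain ⟨L, hLc, hLN, hLm, hL⟩ := exists_isCompact_continuous_decide m h𝒞c
      (fun s hs => hm𝒮 s (h𝒞𝒮 hs)) hNm hN0 hε
    have hcont : ContinuousOn Φ L := by
      rw [continuousOn_iff_continuous_domRestrict]
      refine continuous_pi fun s => (continuous_bool_rng true).2 ?_
      have : (fun x : L => L.domRestrict Φ x s) ⁻¹' {true} = (↑) ⁻¹' (s : Set K) := by
        ext x; simp [Φ]
      rw [this]
      exact hL s s.2
    -- `L` avoids all null pieces, so any piece separating two of its points belongs to 𝒞.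
    have hinj : ∀ x ∈ L, ∀ y ∈ L, Φ x = Φ y → x = y := by
      intro x hx y hy hxy
      by_contra hne
      obtain ⟨s, hs, hsxy⟩ := hsep x y hne
      obtain ⟨i, hi⟩ := mem_iUnion.1 hs
      have hs0 : m s ≠ 0 := by
        intro h0
        have hsN : s ⊆ N := fun z hz => mem_iUnion.2 ⟨i, s, ⟨hi, h0⟩, hz⟩
        exact hsxy ⟨fun h => absurd (hsN h) (disjoint_left.1 hLN hx),
          fun h => absurd (hsN h) (disjoint_left.1 hLN hy)⟩
      have := congrFun hxy ⟨s, mem_iUnion.2 ⟨i, hi, hs0⟩⟩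
      exact hsxy (by simpa [Φ] using this)
    have hcomp : IsCompact (Φ '' (A ∩ L)) :=
      (hLc.inter_left hA).image_of_continuousOn (hcont.mono inter_subset_right)
    -- The compact image is closed, hence measurable in the countable product, so its preimage lies
    -- in the generated σ-algebra. By injectivity on `L` it differs from A only outside `L`.
    refine ⟨Φ ⁻¹' (Φ '' (A ∩ L)), hgen _ (hΦ hcomp.isClosed.measurableSet), ?_, ?_⟩
    · refine (measure_mono fun x hx => ?_).trans hLm
      exact fun hxL => hx.2 ⟨x, ⟨hx.1, hxL⟩, rfl⟩
    · refine (measure_mono fun x hx => ?_).trans hLm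
      intro hxL
      obtain ⟨y, hy, hxy⟩ := hx.1
      exact hx.2 (hinj y hy.2 x hxL hxy ▸ hy.1)
  have hle : ∀ ρ ∈ ({μ, ν} : Set (Measure K)), ∀ s, ρ s ≤ m s := by
    rintro ρ (rfl | rfl) s
    · exact le_self_add
    · exact le_add_self
  have half : ∀ ρ ∈ ({μ, ν} : Set (Measure K)), ∀ ρ' ∈ ({μ, ν} : Set (Measure K)),
      (∀ B, μ B = ν B → ρ B = ρ' B) → ∀ A, IsClosed A → ρ A ≤ ρ' A := by
    intro ρ hρ ρ' hρ' heq A hA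
    refine ENNReal.le_of_forall_pos_le_add fun ε hε _ => ?_
    obtain ⟨B, hB, h1, h2⟩ := key A hA (ε / 2 : ℝ≥0∞)
      (ENNReal.div_pos (by exact_mod_cast hε.ne') (by simp)).ne'
    have e1 : ρ A ≤ ρ B + ρ (A \ B) := by
      refine (measure_mono ?_).trans (measure_union_le _ _)
      intro x hx; by_cases hxB : x ∈ B
      exacts [Or.inl hxB, Or.inr ⟨hx, hxB⟩]
    have e2 : ρ' B ≤ ρ' A + ρ' (B \ A) := by
      refine (measure_mono ?_).trans (measure_union_le _ _)
      intro x hx; by_cases hxB : x ∈ A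
      exacts [Or.inl hxB, Or.inr ⟨hx, hxB⟩]
    calc ρ A ≤ ρ B + ρ (A \ B) := e1
      _ ≤ (ρ' A + ε / 2) + ε / 2 := by
          refine add_le_add ?_ ((hle ρ hρ _).trans h1)
          rw [heq B hB]
          exact e2.trans (add_le_add le_rfl ((hle ρ' hρ' _).trans h2))
      _ = ρ' A + ε := by rw [add_assoc, ENNReal.add_halves]
  have hclosed : ∀ A, IsClosed A → μ A = ν A := fun A hA =>
    le_antisymm (half μ (by simp) ν (by simp) (fun _ h => h) A hA)
      (half ν (by simp) μ (by simp) (fun _ h => h.symm) A hA)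
  exact ext_of_generate_finite _ ((BorelSpace.measurable_eq (α := K)).trans
    borel_eq_generateFrom_isClosed) isPiSystem_isClosed hclosed (hclosed _ isClosed_univ)

end Determination

/-! ### Sums of the n largest terms -/

section TopSum

variable {ι : Type*}

/-- The supremum of the sums of at most `n` terms of a family of real numbers. -/
noncomputable def topSum (n : ℕ) (a : ι → ℝ) : ℝ :=
  ⨆ F : {F : Finset ι // F.card ≤ n}, ∑ v ∈ F.1, a v

lemma bddAbove_topSum {a : ι → ℝ} (ha : ∀ v, 0 ≤ a v) (hs : Summable a) (n : ℕ) :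
    BddAbove (range fun F : {F : Finset ι // F.card ≤ n} => ∑ v ∈ F.1, a v) :=
  ⟨∑' v, a v, by rintro _ ⟨F, rfl⟩; exact hs.sum_le_tsum _ fun v _ => ha v⟩

lemma sum_le_topSum {a : ι → ℝ} (ha : ∀ v, 0 ≤ a v) (hs : Summable a) {n : ℕ} (F : Finset ι)
    (hF : F.card ≤ n) : ∑ v ∈ F, a v ≤ topSum n a :=
  le_ciSup (bddAbove_topSum ha hs n) ⟨F, hF⟩

lemma topSum_zero (a : ι → ℝ) : topSum 0 a = 0 := by
  have : Unique {F : Finset ι // F.card ≤ 0} :=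
    { default := ⟨∅, by simp⟩
      uniq := fun F => Subtype.ext (Finset.card_eq_zero.1 (Nat.le_zero.1 F.2)) }
  have h : (default : {F : Finset ι // F.card ≤ 0}).1 = ∅ :=
    Finset.card_eq_zero.1 (Nat.le_zero.1 (default : {F : Finset ι // F.card ≤ 0}).2)
  rw [topSum, ciSup_unique, h, Finset.sum_empty]

/-- A set on which `c` takes its largest values realizes the supremum of the sums. -/
lemma topSum_card_le_sum {c : ι → ℝ} {r : ℝ} (hr : 0 ≤ r) {F : Finset ι} (h1 : ∀ v ∈ F, r ≤ c v)
    (h2 : ∀ v ∉ F, c v ≤ r) : topSum F.card c ≤ ∑ v ∈ F, c v := by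
  classical
  have : Nonempty {G : Finset ι // G.card ≤ F.card} := ⟨⟨F, le_rfl⟩⟩
  refine ciSup_le fun ⟨G, hG⟩ => ?_
  -- Subtracting the threshold r makes terms in F nonnegative and those outside nonpositive; the
  -- cardinality bound and r ≥ 0 then restore the subtracted multiples.
  have e1 : ∑ v ∈ G, (c v - r) ≤ ∑ v ∈ G ∩ F, (c v - r) := by
    rw [← Finset.sum_inter_add_sum_sdiff G F]
    have : ∑ v ∈ G \ F, (c v - r) ≤ 0 :=
      Finset.sum_nonpos fun v hv => sub_nonpos.2 (h2 v (Finset.mem_sdiff.1 hv).2)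
    linarith
  have e2 : ∑ v ∈ G ∩ F, (c v - r) ≤ ∑ v ∈ F, (c v - r) :=
    Finset.sum_le_sum_of_subset_of_nonneg Finset.inter_subset_right
      fun v hv _ => sub_nonneg.2 (h1 v hv)
  simp only [Finset.sum_sub_distrib, Finset.sum_const, nsmul_eq_mul] at e1 e2
  have e3 : (G.card : ℝ) * r ≤ F.card * r :=
    mul_le_mul_of_nonneg_right (by exact_mod_cast hG) hr
  linarith

/-- Nonnegative summable families for whose sum all the functionals `topSum n` are additive
and which have the same values of these functionals coincide. -/
theorem eq_of_topSum_eq {a b : ι → ℝ} (ha : ∀ v, 0 ≤ a v) (hb : ∀ v, 0 ≤ b v) (hsa : Summable a)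
    (hsb : Summable b) (h : ∀ n, topSum n a = topSum n b)
    (hadd : ∀ n, topSum n (a + b) = topSum n a + topSum n b) : a = b := by
  classical
  set c := a + b with hc
  have hsc : Summable c := hsa.add hsb
  have hc0 : ∀ v, 0 ≤ c v := fun v => add_nonneg (ha v) (hb v)
  -- If F carries the largest values of a + b, additivity forces F to be optimal for a and for b
  -- separately, so their sums over F are the equal values of `topSum`.
  have key : ∀ (F : Finset ι) (r : ℝ), 0 ≤ r → (∀ v ∈ F, r ≤ c v) → (∀ v ∉ F, c v ≤ r) →
      ∑ v ∈ F, a v = ∑ v ∈ F, b v := by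
    intro F r hr h1 h2
    have e := topSum_card_le_sum hr h1 h2
    have e1 := sum_le_topSum ha hsa F le_rfl
    have e2 := sum_le_topSum hb hsb F le_rfl
    have e3 := hadd F.card
    have e4 := h F.card
    have e5 : ∑ v ∈ F, c v = ∑ v ∈ F, a v + ∑ v ∈ F, b v := by
      rw [← Finset.sum_add_distrib]; rfl
    linarith
  funext v
  rcases (hc0 v).eq_or_lt with h0 | hpos
  · have : a v + b v = 0 := h0.symm
    linarith [ha v, hb v]
  · have hfin : {w | c v < c w}.Finite := by
      have := hsc.tendsto_cofinite_zero.eventually (gt_mem_nhds hpos)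
      exact (Filter.eventually_cofinite.1 this).subset fun w hw => not_lt.2 (le_of_lt hw)
    set F := hfin.toFinset with hF
    have memF : ∀ w, w ∈ F ↔ c v < c w := fun w => by simp [hF]
    have hvF : v ∉ F := fun hv => lt_irrefl _ ((memF v).1 hv)
    have k1 := key F (c v) hpos.le (fun w hw => ((memF w).1 hw).le)
      fun w hw => not_lt.1 fun h => hw ((memF w).2 h)
    have k2 := key (insert v F) (c v) hpos.le
      (fun w hw => by
        rcases Finset.mem_insert.1 hw with rfl | hw
        exacts [le_rfl, ((memF w).1 hw).le])
      fun w hw => not_lt.1 fun h => hw (Finset.mem_insert_of_mem ((memF w).2 h))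
    rw [Finset.sum_insert hvF, Finset.sum_insert hvF] at k2
    linarith

end TopSum

/-! ### Suprema of integrals that see the largest pieces -/

section Testing

variable {K : Type*} [TopologicalSpace K]

/-- The continuous functions with values in `[0, 1]` that vanish outside the core and at most `n`
petals. -/
def OpenSunflower.testFunctions (S : OpenSunflower K) (n : ℕ) : Set C(K, ℝ) :=
  {f | (∀ x, 0 ≤ f x ∧ f x ≤ 1) ∧ ∃ F : Finset S.petals, F.card ≤ n ∧
    ∀ x, x ∉ S.core → (∀ v ∈ F, x ∉ (v : Set K)) → f x = 0}

lemma OpenSunflower.zero_mem_testFunctions (S : OpenSunflower K) (n : ℕ) :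
    0 ∈ S.testFunctions n :=
  ⟨fun x => by simp, ∅, by simp, fun x _ _ => rfl⟩

variable [MeasurableSpace K] [BorelSpace K]

lemma integrable_of_compactSpace [CompactSpace K] (μ : Measure K) [IsFiniteMeasure μ]
    (f : C(K, ℝ)) : Integrable f μ :=
  (BoundedContinuousFunction.mkOfCompact f).integrable μ

/-- The measures of the pieces of a sunflower are summable. -/
lemma OpenSunflower.summable_measureReal (S : OpenSunflower K) (μ : Measure K)
    [IsFiniteMeasure μ] : Summable fun v : S.petals => μ.real ((v : Set K) \ S.core) := by
  refine summable_of_sum_le (c := μ.real univ) (fun _ => measureReal_nonneg) fun F => ?_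
  rw [← measureReal_biUnion_finset]
  · exact measureReal_mono (subset_univ _)
  · exact fun v _ w _ hvw => S.pairwiseDisjoint_pieces v.2 w.2 fun h => hvw (Subtype.ext h)
  · exact fun v _ => S.measurableSet_of_mem_pieces ⟨v, v.2, rfl⟩

lemma OpenSunflower.measureReal_core_union (S : OpenSunflower K) (μ : Measure K)
    [IsFiniteMeasure μ] (F : Finset S.petals) :
    μ.real (S.core ∪ ⋃ v ∈ F, (v : Set K)) =
      μ.real S.core + ∑ v ∈ F, μ.real ((v : Set K) \ S.core) := by
  have hdisj : (F : Set S.petals).PairwiseDisjoint fun v => (v : Set K) \ S.core :=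
    fun v _ w _ hvw => S.pairwiseDisjoint_pieces v.2 w.2 fun h => hvw (Subtype.ext h)
  rw [← measureReal_biUnion_finset hdisj
      (fun v _ => S.measurableSet_of_mem_pieces ⟨v, v.2, rfl⟩),
    ← measureReal_union ?_ ?_ (measure_ne_top _ _) (measure_ne_top _ _)]
  · congr 1
    ext x
    simp only [mem_union, mem_iUnion, mem_sdiff, exists_prop]
    by_cases hx : x ∈ S.core <;> simp [hx]
  · exact disjoint_left.2 fun x hx hx' => by
      obtain ⟨v, _, hv⟩ := mem_iUnion₂.1 hx'
      exact hv.2 hx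
  · exact Finset.measurableSet_biUnion _ fun v _ => S.measurableSet_of_mem_pieces ⟨v, v.2, rfl⟩

/-- The supremum of the integrals of the test functions, in terms of the measures of the pieces. -/
lemma OpenSunflower.sSup_integral_testFunctions [CompactSpace K] [T2Space K]
    (S : OpenSunflower K) (n : ℕ) (μ : Measure K) [IsFiniteMeasure μ] [μ.InnerRegular] :
    sSup ((fun f : C(K, ℝ) => ∫ x, f x ∂μ) '' S.testFunctions n) =
      μ.real S.core + topSum n fun v : S.petals => μ.real ((v : Set K) \ S.core) := by
  have hsum := S.summable_measureReal μ
  have hnn : ∀ v : S.petals, 0 ≤ μ.real ((v : Set K) \ S.core) := fun _ => measureReal_nonneg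
  have hopen : ∀ F : Finset S.petals, IsOpen (S.core ∪ ⋃ v ∈ F, (v : Set K)) := fun F =>
    S.isOpen_core.union (isOpen_biUnion fun v _ => S.isOpen_petal v v.2)
  have hub : ∀ f ∈ S.testFunctions n, ∫ x, f x ∂μ ≤
      μ.real S.core + topSum n fun v : S.petals => μ.real ((v : Set K) \ S.core) := by
    rintro f ⟨hf, F, hF, hf0⟩
    calc ∫ x, f x ∂μ ≤ ∫ x, (S.core ∪ ⋃ v ∈ F, (v : Set K)).indicator 1 x ∂μ := by
          refine integral_mono (integrable_of_compactSpace μ f)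
            ((integrable_const (1 : ℝ)).indicator (hopen F).measurableSet) fun x => ?_
          by_cases hx : x ∈ S.core ∪ ⋃ v ∈ F, (v : Set K)
          · rw [indicator_of_mem hx]; exact (hf x).2
          · rw [indicator_of_notMem hx]
            refine (hf0 x (fun h => hx (Or.inl h)) fun v hv h => hx (Or.inr ?_)).le
            exact mem_iUnion₂.2 ⟨v, hv, h⟩
      _ = μ.real S.core + ∑ v ∈ F, μ.real ((v : Set K) \ S.core) := by
          rw [integral_indicator_one (hopen F).measurableSet, S.measureReal_core_union]
      _ ≤ _ := by gcongr; exact sum_le_topSum hnn hsum F hF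
  have hbdd : BddAbove ((fun f : C(K, ℝ) => ∫ x, f x ∂μ) '' S.testFunctions n) :=
    ⟨_, by rintro _ ⟨f, hf, rfl⟩; exact hub f hf⟩
  refine le_antisymm (csSup_le ⟨_, 0, S.zero_mem_testFunctions n, rfl⟩ ?_) ?_
  · rintro _ ⟨f, hf, rfl⟩; exact hub f hf
  · have : Nonempty {G : Finset S.petals // G.card ≤ n} := ⟨⟨∅, by simp⟩⟩
    rw [← le_sub_iff_add_le']
    refine ciSup_le fun ⟨F, hF⟩ => ?_
    rw [le_sub_iff_add_le', ← S.measureReal_core_union]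
    -- The open union of the core and the petals in F is approximated from inside by a compact set,
    -- and a Urysohn function between the two is a test function.
    refine le_of_forall_pos_le_add fun ε hε => ?_
    obtain ⟨C, hCsub, hC, hCμ⟩ := (hopen F).measurableSet.exists_isCompact_lt_add
      (measure_ne_top μ _) (ENNReal.ofReal_pos.2 hε).ne'
    obtain ⟨f, hf0, hf1, hf⟩ := exists_continuous_zero_one_of_isClosed
      (hopen F).isClosed_compl hC.isClosed (disjoint_compl_left_iff_subset.2 hCsub)
    have hfmem : f ∈ S.testFunctions n := by
      refine ⟨fun x => hf x, F, hF, fun x hx hx' => hf0 ?_⟩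
      rintro (h | h)
      · exact hx h
      · obtain ⟨v, hv, h⟩ := mem_iUnion₂.1 h
        exact hx' v hv h
    have h1 : μ.real C ≤ ∫ x, f x ∂μ := by
      rw [← integral_indicator_one hC.measurableSet]
      refine integral_mono ((integrable_const (1 : ℝ)).indicator hC.measurableSet)
        (integrable_of_compactSpace μ f) fun x => ?_
      by_cases hx : x ∈ C
      · rw [indicator_of_mem hx]; exact (hf1 hx).ge
      · rw [indicator_of_notMem hx]; exact (hf x).1
    have h2 : μ.real (S.core ∪ ⋃ v ∈ F, (v : Set K)) ≤ μ.real C + ε := by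
      have := ENNReal.toReal_mono (by finiteness) hCμ.le
      rwa [ENNReal.toReal_add (by finiteness) (by finiteness), ENNReal.toReal_ofReal hε.le] at this
    exact h2.trans (by gcongr; exact h1.trans (le_csSup hbdd ⟨f, hfmem, rfl⟩))

end Testing

/-- Positive functionals on `C(K)` are integrals with respect to finite regular measures. -/
lemma exists_regular_measure_of_nonneg {K : Type*} [TopologicalSpace K] [CompactSpace K]
    [T2Space K] [MeasurableSpace K] [BorelSpace K] (Λ : C(K, ℝ) →ₗ[ℝ] ℝ)
    (hΛ : ∀ f : C(K, ℝ), (∀ x, 0 ≤ f x) → 0 ≤ Λ f) :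
    ∃ μ : Measure K, IsFiniteMeasure μ ∧ μ.Regular ∧ ∀ f : C(K, ℝ), Λ f = ∫ x, f x ∂μ := by
  let Λ' : CompactlySupportedContinuousMap K ℝ →ₚ[ℝ] ℝ := PositiveLinearMap.mk₀
    { toFun := fun f => Λ f.toContinuousMap
      map_add' := fun f g => Λ.map_add f.toContinuousMap g.toContinuousMap
      map_smul' := fun c f => Λ.map_smul c f.toContinuousMap } fun f hf => hΛ _ fun x => hf x
  refine ⟨RealRMK.rieszMeasure Λ', inferInstance, inferInstance, fun f => ?_⟩
  exact (RealRMK.integral_rieszMeasure Λ' ⟨f, HasCompactSupport.of_compactSpace _⟩).symm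

/-- On a Gruenhage compact space, countably many suprema of positive functionals over sets of test
functions are jointly strictly convex. -/
theorem exists_testSets_of_isGruenhageSpace {K : Type*} [TopologicalSpace K] [CompactSpace K]
    [T2Space K] (hK : IsGruenhageSpace K) :
    ∃ (ι : Type) (_ : Countable ι) (A : ι → Set C(K, ℝ)),
      (∀ i, 0 ∈ A i) ∧ (∀ i, ∀ f ∈ A i, ∀ x, 0 ≤ f x ∧ f x ≤ 1) ∧ (∃ i, 1 ∈ A i) ∧
      ∀ Λ Λ' : C(K, ℝ) →ₗ[ℝ] ℝ, (∀ f : C(K, ℝ), (∀ x, 0 ≤ f x) → 0 ≤ Λ f) →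
        (∀ f : C(K, ℝ), (∀ x, 0 ≤ f x) → 0 ≤ Λ' f) →
        (∀ i, sSup (Λ '' A i) = sSup (Λ' '' A i)) →
        (∀ i, sSup ((Λ + Λ' : C(K, ℝ) →ₗ[ℝ] ℝ) '' A i) = sSup (Λ '' A i) + sSup (Λ' '' A i)) →
        Λ = Λ' := by
  obtain ⟨ι, hι, S, hpi, huniv, hsep⟩ := OpenSunflower.exists_of_isGruenhageSpace hK
  -- The extra index `none` contributes the total mass, which later bounds the norms of positive
  -- functionals.
  let A : Option (ι × ℕ) → Set C(K, ℝ) := fun o => o.elim {0, 1} fun j => (S j.1).testFunctions j.2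
  refine ⟨Option (ι × ℕ), inferInstance, A, ?_, ?_, ⟨none, Or.inr rfl⟩, ?_⟩
  · rintro (_ | ⟨i, n⟩)
    exacts [Or.inl rfl, (S i).zero_mem_testFunctions n]
  · rintro (_ | ⟨i, n⟩) f hf
    · rcases hf with rfl | rfl <;> intro x <;> simp
    · exact hf.1
  intro Λ Λ' hΛ hΛ' heq hadd
  let _ : MeasurableSpace K := borel K
  have : BorelSpace K := ⟨rfl⟩
  obtain ⟨μ, _, _, hμ⟩ := exists_regular_measure_of_nonneg Λ hΛ
  obtain ⟨ν, _, _, hν⟩ := exists_regular_measure_of_nonneg Λ' hΛ'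
  have hμν : ∀ f : C(K, ℝ), (Λ + Λ' : C(K, ℝ) →ₗ[ℝ] ℝ) f = ∫ x, f x ∂(μ + ν) := fun f => by
    rw [integral_add_measure (integrable_of_compactSpace μ f) (integrable_of_compactSpace ν f),
      ← hμ, ← hν, LinearMap.add_apply]
  have s1 : ∀ i n, sSup (Λ '' A (some (i, n))) = μ.real (S i).core +
      topSum n fun v : (S i).petals => μ.real ((v : Set K) \ (S i).core) := fun i n => by
    rw [← (S i).sSup_integral_testFunctions n μ, show (Λ : C(K, ℝ) → ℝ) = _ from funext hμ]; rfl
  have s2 : ∀ i n, sSup (Λ' '' A (some (i, n))) = ν.real (S i).core +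
      topSum n fun v : (S i).petals => ν.real ((v : Set K) \ (S i).core) := fun i n => by
    rw [← (S i).sSup_integral_testFunctions n ν, show (Λ' : C(K, ℝ) → ℝ) = _ from funext hν]; rfl
  have s3 : ∀ i n, sSup ((Λ + Λ' : C(K, ℝ) →ₗ[ℝ] ℝ) '' A (some (i, n))) =
      (μ + ν).real (S i).core +
        topSum n fun v : (S i).petals => (μ + ν).real ((v : Set K) \ (S i).core) := fun i n => by
    rw [← (S i).sSup_integral_testFunctions n (μ + ν),
      show ((Λ + Λ' : C(K, ℝ) →ₗ[ℝ] ℝ) : C(K, ℝ) → ℝ) = _ from funext hμν]; rfl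
  -- No petals are allowed for n = 0, so the supremum is the mass of the core alone.
  have hcore : ∀ i, μ.real (S i).core = ν.real (S i).core := fun i => by
    have := heq (some (i, 0))
    rwa [s1, s2, topSum_zero, topSum_zero, add_zero, add_zero] at this
  have hpieces : ∀ s ∈ ⋃ i, (S i).pieces, μ s = ν s := by
    intro s hs
    obtain ⟨i, v, hv, rfl⟩ := mem_iUnion.1 hs
    have e := eq_of_topSum_eq (fun _ => measureReal_nonneg) (fun _ => measureReal_nonneg)
      ((S i).summable_measureReal μ) ((S i).summable_measureReal ν)
      (fun n => by have := heq (some (i, n)); rw [s1, s2, hcore] at this; linarith)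
      (fun n => by
        have := hadd (some (i, n))
        rw [s1, s2, s3] at this
        have e : (fun v : (S i).petals => (μ + ν).real ((v : Set K) \ (S i).core)) =
            (fun v : (S i).petals => μ.real ((v : Set K) \ (S i).core)) +
              fun v : (S i).petals => ν.real ((v : Set K) \ (S i).core) :=
          funext fun v => measureReal_add_apply
        rw [e, measureReal_add_apply] at this
        linarith)
    exact (measureReal_eq_measureReal_iff).1 (congrFun e ⟨v, hv⟩)
  have : μ = ν := measure_ext_of_pieces hpi huniv hsep hpieces
  exact LinearMap.ext fun f => by rw [hμ, hν, this]

/-! ### Weighted ℓ² combinations and their rotundity -/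

section L2Comb

variable {ι : Type*}

/-- The weighted `ℓ²` norm of a family of real numbers. -/
noncomputable def l2Comb (w a : ι → ℝ) : ℝ := √(∑' i, w i * a i ^ 2)

variable {w a b c : ι → ℝ}

lemma l2Comb_nonneg : 0 ≤ l2Comb w a := Real.sqrt_nonneg _

lemma l2Comb_sq (hw : ∀ i, 0 ≤ w i) : l2Comb w a ^ 2 = ∑' i, w i * a i ^ 2 :=
  Real.sq_sqrt (tsum_nonneg fun i => mul_nonneg (hw i) (sq_nonneg _))

lemma summable_l2_of_le (hw : ∀ i, 0 ≤ w i) (hs : Summable w) (ha : ∀ i, 0 ≤ a i) {C : ℝ}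
    (hC : ∀ i, a i ≤ C) : Summable fun i => w i * a i ^ 2 :=
  Summable.of_nonneg_of_le (fun i => mul_nonneg (hw i) (sq_nonneg _))
    (fun i => mul_le_mul_of_nonneg_left (pow_le_pow_left₀ (ha i) (hC i) 2) (hw i))
    (hs.mul_right (C ^ 2))

lemma l2Comb_const_mul (r : ℝ) : l2Comb w (fun i => r * a i) = |r| * l2Comb w a := by
  rw [l2Comb, l2Comb, ← Real.sqrt_sq_eq_abs, ← Real.sqrt_mul (sq_nonneg r), ← tsum_mul_left]
  congr 2
  funext i
  ring

lemma sqrt_weight_mul_le_l2Comb (hw : ∀ i, 0 ≤ w i) (hs : Summable fun i => w i * a i ^ 2) (i : ι) :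
    √(w i) * a i ≤ l2Comb w a := by
  refine Real.le_sqrt_of_sq_le ?_
  rw [mul_pow, Real.sq_sqrt (hw i)]
  exact hs.le_tsum i fun j _ => mul_nonneg (hw j) (sq_nonneg _)

lemma l2Comb_mono (hw : ∀ i, 0 ≤ w i) (ha : ∀ i, 0 ≤ a i) (hab : ∀ i, a i ≤ b i)
    (hsb : Summable fun i => w i * b i ^ 2) : l2Comb w a ≤ l2Comb w b := by
  have h : ∀ i, w i * a i ^ 2 ≤ w i * b i ^ 2 := fun i =>
    mul_le_mul_of_nonneg_left (pow_le_pow_left₀ (ha i) (hab i) 2) (hw i)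
  exact Real.sqrt_le_sqrt (Summable.tsum_le_tsum h
    (Summable.of_nonneg_of_le (fun i => mul_nonneg (hw i) (sq_nonneg _)) h hsb) hsb)

/-- Minkowski's inequality from (a + b)² ≤ (1 + B/A) a² + (1 + A/B) b², where A and B are the two
norms enlarged by ε/2 so that the quotients make sense. -/
lemma l2Comb_le_add (hw : ∀ i, 0 ≤ w i) (hc : ∀ i, 0 ≤ c i) (hcab : ∀ i, c i ≤ a i + b i)
    (hsa : Summable fun i => w i * a i ^ 2) (hsb : Summable fun i => w i * b i ^ 2) :
    l2Comb w c ≤ l2Comb w a + l2Comb w b := by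
  refine le_of_forall_pos_le_add fun ε hε => ?_
  have hA0 : 0 ≤ l2Comb w a := l2Comb_nonneg
  have hB0 : 0 ≤ l2Comb w b := l2Comb_nonneg
  have hA2 := l2Comb_sq (a := a) hw
  have hB2 := l2Comb_sq (a := b) hw
  set A := l2Comb w a + ε / 2 with hA
  set B := l2Comb w b + ε / 2 with hB
  have hApos : 0 < A := by positivity
  have hBpos : 0 < B := by positivity
  have hterm : ∀ i, w i * c i ^ 2 ≤ (1 + B / A) * (w i * a i ^ 2) + (1 + A / B) * (w i * b i ^ 2) := by
    intro i
    have h1 : c i ^ 2 ≤ (a i + b i) ^ 2 := pow_le_pow_left₀ (hc i) (hcab i) 2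
    have h2 : (1 + B / A) * a i ^ 2 + (1 + A / B) * b i ^ 2 - (a i + b i) ^ 2
        = (B * a i - A * b i) ^ 2 / (A * B) := by field_simp; ring
    have h3 : 0 ≤ (B * a i - A * b i) ^ 2 / (A * B) := by positivity
    nlinarith [hw i]
  have hs := (hsa.mul_left (1 + B / A)).add (hsb.mul_left (1 + A / B))
  have hsc : Summable fun i => w i * c i ^ 2 :=
    Summable.of_nonneg_of_le (fun i => mul_nonneg (hw i) (sq_nonneg _)) hterm hs
  have hle : l2Comb w c ^ 2 ≤ (A + B) ^ 2 := by
    rw [l2Comb_sq hw]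
    calc ∑' i, w i * c i ^ 2 ≤ _ := hsc.tsum_le_tsum hterm hs
      _ = (1 + B / A) * l2Comb w a ^ 2 + (1 + A / B) * l2Comb w b ^ 2 := by
          rw [(hsa.mul_left _).tsum_add (hsb.mul_left _), tsum_mul_left, tsum_mul_left, hA2, hB2]
      _ ≤ (1 + B / A) * A ^ 2 + (1 + A / B) * B ^ 2 := by gcongr <;> linarith
      _ = (A + B) ^ 2 := by field_simp; ring
  have := (le_abs_self _).trans (abs_le_of_sq_le_sq hle (by positivity))
  linarith

/-- Equality in the triangle inequality for vectors of equal norm. -/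
lemma eq_of_l2Comb_eq (hw : ∀ i, 0 < w i) (ha : ∀ i, 0 ≤ a i) (hb : ∀ i, 0 ≤ b i)
    (hc : ∀ i, 0 ≤ c i) (hcab : ∀ i, c i ≤ a i + b i)
    (hsa : Summable fun i => w i * a i ^ 2) (hsb : Summable fun i => w i * b i ^ 2)
    (hab : l2Comb w a = l2Comb w b) (h : l2Comb w a + l2Comb w b ≤ l2Comb w c) (i : ι) :
    a i = b i ∧ c i = a i + b i := by
  have hw' : ∀ i, 0 ≤ w i := fun i => (hw i).le
  have hsc : Summable fun i => w i * c i ^ 2 := by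
    refine Summable.of_nonneg_of_le (fun i => mul_nonneg (hw' i) (sq_nonneg _)) (fun i => ?_)
      ((hsa.mul_left 2).add (hsb.mul_left 2))
    have h1 : c i ^ 2 ≤ (a i + b i) ^ 2 := pow_le_pow_left₀ (hc i) (hcab i) 2
    nlinarith [hw' i, mul_le_mul_of_nonneg_left h1 (hw' i), mul_nonneg (hw' i) (sq_nonneg (a i - b i))]
  -- The parallelogram defect splits termwise into two nonnegative parts, one measuring a i ≠ b i
  -- and one measuring c i < a i + b i. Equality makes the total defect vanish.
  set d : ι → ℝ := fun i => 2 * (w i * a i ^ 2) + 2 * (w i * b i ^ 2) - w i * c i ^ 2 with hd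
  have hsd : HasSum d (2 * l2Comb w a ^ 2 + 2 * l2Comb w b ^ 2 - l2Comb w c ^ 2) := by
    rw [l2Comb_sq hw', l2Comb_sq hw', l2Comb_sq hw']
    exact ((hsa.hasSum.mul_left 2).add (hsb.hasSum.mul_left 2)).sub hsc.hasSum
  have key : ∀ i, w i * (a i - b i) ^ 2 + w i * ((a i + b i) ^ 2 - c i ^ 2) = d i := fun i => by
    simp only [hd]; ring
  have n1 : ∀ i, 0 ≤ w i * (a i - b i) ^ 2 := fun i => mul_nonneg (hw' i) (sq_nonneg _)
  have n2 : ∀ i, 0 ≤ w i * ((a i + b i) ^ 2 - c i ^ 2) := fun i =>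
    mul_nonneg (hw' i) (sub_nonneg.2 (pow_le_pow_left₀ (hc i) (hcab i) 2))
  have hd0 : ∀ i, 0 ≤ d i := fun i => by rw [← key]; exact add_nonneg (n1 i) (n2 i)
  have hsum : 2 * l2Comb w a ^ 2 + 2 * l2Comb w b ^ 2 - l2Comb w c ^ 2 = 0 := by
    refine le_antisymm ?_ (hsd.nonneg hd0)
    have h0 : 0 ≤ l2Comb w a + l2Comb w b := add_nonneg l2Comb_nonneg l2Comb_nonneg
    have := pow_le_pow_left₀ h0 h 2
    rw [hab] at *
    nlinarith
  rw [hsum] at hsd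
  have hdi : d i = 0 := congrFun ((hasSum_zero_iff_of_nonneg hd0).1 hsd) i
  have e1 : w i * (a i - b i) ^ 2 = 0 := by linarith [key i, n1 i, n2 i]
  have e2 : w i * ((a i + b i) ^ 2 - c i ^ 2) = 0 := by linarith [key i, n1 i, n2 i]
  have f1 := (mul_eq_zero.1 e1).resolve_left (hw i).ne'
  have f2 := (mul_eq_zero.1 e2).resolve_left (hw i).ne'
  refine ⟨sub_eq_zero.1 (pow_eq_zero_iff (two_ne_zero) |>.1 f1), ?_⟩
  exact ((pow_left_inj₀ (add_nonneg (ha i) (hb i)) (hc i) two_ne_zero).1 (sub_eq_zero.1 f2)).symm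

lemma lowerSemicontinuous_l2Comb {Y : Type*} [TopologicalSpace Y] {φ : ι → Y → ℝ}
    (hw : ∀ i, 0 ≤ w i) (hφ : ∀ i, LowerSemicontinuous (φ i)) (h0 : ∀ i y, 0 ≤ φ i y)
    (hs : ∀ y, Summable fun i => w i * φ i y ^ 2) :
    LowerSemicontinuous fun y => l2Comb w fun i => φ i y := by
  rw [lowerSemicontinuous_iff_isClosed_preimage]
  intro r
  rcases lt_or_ge r 0 with hr | hr
  · convert isClosed_empty
    ext y
    simp only [mem_preimage, mem_Iic, mem_empty_iff_false, iff_false, not_le]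
    exact hr.trans_le l2Comb_nonneg
  · have hsq : ∀ i, LowerSemicontinuous fun y => w i * φ i y ^ 2 := by
      intro i
      -- Squaring is monotone only on nonnegative reals; the truncation changes nothing on the
      -- values of φ i.
      have hg : Continuous fun u : ℝ => w i * (max u 0) ^ 2 := by fun_prop
      have hm : Monotone fun u : ℝ => w i * (max u 0) ^ 2 := fun u v huv =>
        mul_le_mul_of_nonneg_left
          (pow_le_pow_left₀ (le_max_right _ _) (max_le_max_right 0 huv) 2) (hw i)
      have := hg.comp_lowerSemicontinuous (hφ i) hm
      refine fun y => ?_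
      convert this y using 2 with z
      simp [max_eq_left (h0 i z)]
    have heq : (fun y => l2Comb w fun i => φ i y) ⁻¹' Iic r
        = ⋂ F : Finset ι, (fun y => ∑ i ∈ F, w i * φ i y ^ 2) ⁻¹' Iic (r ^ 2) := by
      ext y
      simp only [mem_preimage, mem_Iic, mem_iInter, l2Comb]
      rw [Real.sqrt_le_left hr]
      refine ⟨fun h F => ((hs y).sum_le_tsum F fun i _ =>
        mul_nonneg (hw i) (sq_nonneg _)).trans h, fun h => ?_⟩
      exact (hs y).tsum_le_of_sum_le h
    rw [heq]
    exact isClosed_iInter fun F => lowerSemicontinuous_iff_isClosed_preimage.1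
      (lowerSemicontinuous_sum fun i _ => hsq i) _

variable {X : Type*} [AddCommGroup X] [Module ℝ X]

/-- The `ℓ²` combination of a pointwise bounded family of seminorms. -/
noncomputable def l2Seminorm (w : ι → ℝ) (hw : ∀ i, 0 ≤ w i) (hs : Summable w)
    (q : ι → Seminorm ℝ X) (hq : ∀ x, ∃ C, ∀ i, q i x ≤ C) : Seminorm ℝ X :=
  have hsum : ∀ x, Summable fun i => w i * q i x ^ 2 := fun x =>
    summable_l2_of_le hw hs (fun i => apply_nonneg (q i) x) (hq x).choose_spec
  Seminorm.of (fun x => l2Comb w fun i => q i x)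
    (fun x y => l2Comb_le_add hw (fun i => apply_nonneg (q i) _)
      (fun i => map_add_le_add (q i) x y) (hsum x) (hsum y))
    (fun r x => by
      simp only [map_smul_eq_mul]
      rw [l2Comb_const_mul, Real.norm_eq_abs, abs_abs])

end L2Comb

/-! ### Minimization over fibres of a closed relation -/

section Minimization

variable {X Z : Type*} {h : Z → ℝ} {R : Set (X × Z)}
  {P : Set Z}

/-- The infimum of `h` over the fibre of `R` at `x` inside `P`. -/
noncomputable def fibreInf (h : Z → ℝ) (R : Set (X × Z)) (P : Set Z) (x : X) : ℝ :=
  sInf (h '' {z | z ∈ P ∧ (x, z) ∈ R})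

lemma fibreInf_le (h0 : ∀ z, 0 ≤ h z) {x : X} {z : Z} (hz : z ∈ P) (hR : (x, z) ∈ R) :
    fibreInf h R P x ≤ h z :=
  csInf_le ⟨0, by rintro _ ⟨z, _, rfl⟩; exact h0 z⟩ ⟨z, ⟨hz, hR⟩, rfl⟩

variable [TopologicalSpace X] [TopologicalSpace Z]

lemma exists_fibreInf_eq (hh : LowerSemicontinuous h) (h0 : ∀ z, 0 ≤ h z) (hR : IsClosed R)
    (hcomp : ∀ r, IsCompact {z | z ∈ P ∧ h z ≤ r}) {x : X} (hne : ∃ z ∈ P, (x, z) ∈ R) :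
    ∃ z ∈ P, (x, z) ∈ R ∧ h z = fibreInf h R P x := by
  obtain ⟨z₀, hz₀, hz₀R⟩ := hne
  have hfib : IsClosed {z | (x, z) ∈ R} := hR.preimage (by fun_prop : Continuous fun z => (x, z))
  obtain ⟨z, ⟨⟨hzP, hz⟩, hzR⟩, hmin⟩ := LowerSemicontinuousOn.exists_isMinOn
    (s := {z | z ∈ P ∧ h z ≤ h z₀} ∩ {z | (x, z) ∈ R}) ⟨z₀, ⟨hz₀, le_rfl⟩, hz₀R⟩
    ((hcomp _).inter_right hfib) (hh.lowerSemicontinuousOn _)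
  refine ⟨z, hzP, hzR, le_antisymm (le_csInf ⟨_, z₀, ⟨hz₀, hz₀R⟩, rfl⟩ ?_) (fibreInf_le h0 hzP hzR)⟩
  rintro _ ⟨z', ⟨hz'P, hz'R⟩, rfl⟩
  rcases le_total (h z') (h z₀) with hle | hle
  · exact hmin ⟨⟨hz'P, hle⟩, hz'R⟩
  · exact hz.trans hle

/-- Since the infimum is attained, a sublevel set is the projection of a closed set along a compact
factor, hence closed. -/
lemma lowerSemicontinuous_fibreInf (hh : LowerSemicontinuous h) (h0 : ∀ z, 0 ≤ h z)
    (hR : IsClosed R) (hcomp : ∀ r, IsCompact {z | z ∈ P ∧ h z ≤ r})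
    (hne : ∀ x, ∃ z ∈ P, (x, z) ∈ R) : LowerSemicontinuous (fibreInf h R P) := by
  rw [lowerSemicontinuous_iff_isClosed_preimage]
  intro r
  have : CompactSpace {z | z ∈ P ∧ h z ≤ r} := isCompact_iff_compactSpace.1 (hcomp r)
  have hcl : IsClosed {y : X × {z | z ∈ P ∧ h z ≤ r} | (y.1, (y.2 : Z)) ∈ R} :=
    hR.preimage (by fun_prop)
  convert isClosedMap_fst_of_compactSpace _ hcl using 1
  ext x
  constructor
  · intro hx
    obtain ⟨z, hzP, hzR, hz⟩ := exists_fibreInf_eq hh h0 hR hcomp (hne x)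
    exact ⟨(x, ⟨z, hzP, hz.trans_le hx⟩), hzR, rfl⟩
  · rintro ⟨⟨x', z, hzP, hz⟩, hzR, rfl⟩
    exact (fibreInf_le h0 hzP hzR).trans hz

end Minimization

/-! ### Suprema of functionals over sets of test functions -/

section SupOn

variable {K : Type*} [TopologicalSpace K]

/-- The supremum of a functional over a set of continuous functions. -/
noncomputable def supOn (A : Set C(K, ℝ)) (Λ : WeakDual ℝ C(K, ℝ)) : ℝ := sSup (Λ '' A)

/-- Nonnegativity of a functional on `C(K)` on nonnegative functions. -/
def IsPositiveFunctional (Λ : WeakDual ℝ C(K, ℝ)) : Prop :=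
  ∀ f : C(K, ℝ), (∀ x, 0 ≤ f x) → 0 ≤ Λ f

lemma isClosed_isPositiveFunctional :
    IsClosed {Λ : WeakDual ℝ C(K, ℝ) | IsPositiveFunctional Λ} := by
  simp only [IsPositiveFunctional, ofPred_forall]
  exact isClosed_iInter fun f => isClosed_iInter fun _ =>
    isClosed_le continuous_const (WeakDual.eval_continuous f)

lemma supOn_smul {A : Set C(K, ℝ)} {c : ℝ} (hc : 0 ≤ c) (Λ : WeakDual ℝ C(K, ℝ)) :
    supOn A (c • Λ) = c * supOn A Λ := by
  rw [supOn, supOn, ← smul_eq_mul, ← Real.sSup_smul_of_nonneg hc, ← image_smul, image_image]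
  rfl

variable [CompactSpace K]

/-- Positivity is applied to ‖f‖·1 ± f. Control of the total mass therefore gives norm bounds, and
so weak* compactness. -/
lemma IsPositiveFunctional.norm_le {Λ : WeakDual ℝ C(K, ℝ)} (hΛ : IsPositiveFunctional Λ) :
    ‖WeakDual.toStrongDual Λ‖ ≤ Λ 1 := by
  refine ContinuousLinearMap.opNorm_le_bound _ (hΛ 1 fun x => zero_le_one) fun f => ?_
  have h1 := hΛ (‖f‖ • 1 - f) fun x => by
    have := (le_abs_self _).trans (f.norm_coe_le_norm x)
    simpa using this
  have h2 := hΛ (‖f‖ • 1 + f) fun x => by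
    have := (neg_le_abs _).trans (f.norm_coe_le_norm x)
    simp only [ContinuousMap.add_apply, ContinuousMap.smul_apply, ContinuousMap.one_apply,
      smul_eq_mul, mul_one]
    linarith
  rw [map_sub, map_smul, smul_eq_mul] at h1
  rw [map_add, map_smul, smul_eq_mul] at h2
  rw [WeakDual.toStrongDual_apply, Real.norm_eq_abs, abs_le]
  constructor <;> linarith

variable {A : Set C(K, ℝ)}

section

variable (h1 : ∀ f ∈ A, ∀ x, 0 ≤ f x ∧ f x ≤ 1) (Λ Λ' : WeakDual ℝ C(K, ℝ))
include h1

lemma apply_le_norm_of_mem {f : C(K, ℝ)} (hf : f ∈ A) : Λ f ≤ ‖WeakDual.toStrongDual Λ‖ := by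
  have hf1 : ‖f‖ ≤ 1 := (ContinuousMap.norm_le f zero_le_one).2 fun x => by
    rw [Real.norm_eq_abs, abs_of_nonneg (h1 f hf x).1]
    exact (h1 f hf x).2
  exact (le_abs_self _).trans ((WeakDual.toStrongDual Λ).unit_le_opNorm f hf1)

lemma bddAbove_image_of_mem : BddAbove (Λ '' A) :=
  ⟨‖WeakDual.toStrongDual Λ‖, by rintro _ ⟨f, hf, rfl⟩; exact apply_le_norm_of_mem h1 Λ hf⟩

lemma le_supOn {f : C(K, ℝ)} (hf : f ∈ A) : Λ f ≤ supOn A Λ :=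
  le_csSup (bddAbove_image_of_mem h1 Λ) ⟨f, hf, rfl⟩

lemma supOn_le_norm (h0 : 0 ∈ A) : supOn A Λ ≤ ‖WeakDual.toStrongDual Λ‖ :=
  csSup_le ⟨_, 0, h0, rfl⟩ (by rintro _ ⟨f, hf, rfl⟩; exact apply_le_norm_of_mem h1 Λ hf)

lemma supOn_nonneg (h0 : 0 ∈ A) : 0 ≤ supOn A Λ := by
  have := le_supOn h1 Λ h0
  rwa [map_zero] at this

lemma supOn_add_le (h0 : 0 ∈ A) : supOn A (Λ + Λ') ≤ supOn A Λ + supOn A Λ' := by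
  refine csSup_le ⟨_, 0, h0, rfl⟩ ?_
  rintro _ ⟨f, hf, rfl⟩
  exact add_le_add (le_supOn h1 Λ hf) (le_supOn h1 Λ' hf)

lemma lowerSemicontinuous_supOn : LowerSemicontinuous (supOn A) := by
  have : supOn A = fun Λ => ⨆ f : A, Λ (f : C(K, ℝ)) := by
    funext Λ; exact sSup_image'
  rw [this]
  refine lowerSemicontinuous_ciSup (fun Λ => ?_) fun f =>
    (WeakDual.eval_continuous (f : C(K, ℝ))).lowerSemicontinuous
  obtain ⟨C, hC⟩ := bddAbove_image_of_mem h1 Λ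
  exact ⟨C, by rintro _ ⟨f, rfl⟩; exact hC ⟨f, f.2, rfl⟩⟩

end

end SupOn

/-! ### Transfer of strict convexity through approximate representations -/

section Transfer

variable {K : Type*} [TopologicalSpace K] {ι : Type*} {A : ι → Set C(K, ℝ)}
  {w : Option ι → ℝ} {δ : ℝ}

/-- The entries of the cost of an approximation error together with a pair of functionals. -/
noncomputable def costVec (A : ι → Set C(K, ℝ)) (δ : ℝ) (z : ℝ × (Bool → WeakDual ℝ C(K, ℝ)))
    (j : Bool × Option ι) : ℝ :=
  -- The error is counted once per Boolean value, which keeps the index set a product.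
  j.2.elim |z.1| fun i => δ * supOn (A i) (z.2 j.1)

/-- The cost of an approximation error together with a pair of functionals. -/
noncomputable def transferCost (w : Option ι → ℝ) (A : ι → Set C(K, ℝ)) (δ : ℝ)
    (z : ℝ × (Bool → WeakDual ℝ C(K, ℝ))) : ℝ :=
  l2Comb (fun j => w j.2) (costVec A δ z)

lemma summable_comp_snd {κ : Type*} {w : κ → ℝ} (hw : ∀ i, 0 ≤ w i) (hs : Summable w) :
    Summable fun j : Bool × κ => w j.2 :=
  (summable_prod_of_nonneg fun j => hw j.2).2 ⟨fun _ => hs, .of_finite⟩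

lemma transferCost_smul {c : ℝ} (hc : 0 ≤ c) (z : ℝ × (Bool → WeakDual ℝ C(K, ℝ))) :
    transferCost w A δ (c • z) = c * transferCost w A δ z := by
  rw [transferCost, transferCost, ← abs_of_nonneg hc, ← l2Comb_const_mul, abs_of_nonneg hc]
  congr 1
  funext ⟨b, o⟩
  rcases o with _ | i
  · show |c * z.1| = c * |z.1|
    rw [abs_mul, abs_of_nonneg hc]
  · show δ * supOn (A i) (c • z.2 b) = c * (δ * supOn (A i) (z.2 b))
    rw [supOn_smul hc]
    ring

lemma transferCost_swap (z : ℝ × (Bool → WeakDual ℝ C(K, ℝ))) :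
    transferCost w A δ (z.1, fun b => z.2 (!b)) = transferCost w A δ z := by
  rw [transferCost, transferCost, l2Comb, l2Comb]
  congr 1
  exact (Equiv.prodCongr Equiv.boolNot (Equiv.refl (Option ι))).tsum_eq
    fun j => w j.2 * costVec A δ z j ^ 2

variable {X : Type*} [AddCommGroup X] [Module ℝ X] {Γ : Type*}

/-- The pairs consisting of a vector and of an error bound with two functionals whose difference
represents the vector up to the error. -/
def transferRel (l : Γ → X →ₗ[ℝ] ℝ) (e : Γ → C(K, ℝ)) :
    Set (X × (ℝ × (Bool → WeakDual ℝ C(K, ℝ)))) :=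
  {y | ∀ γ, |l γ y.1 - (y.2.2 true (e γ) - y.2.2 false (e γ))| ≤ y.2.1}

variable {l : Γ → X →ₗ[ℝ] ℝ} {e : Γ → C(K, ℝ)}

lemma isClosed_transferRel [TopologicalSpace X] (hl : ∀ γ, Continuous (l γ)) :
    IsClosed (transferRel l e) := by
  simp only [transferRel, ofPred_forall]
  refine isClosed_iInter fun γ => isClosed_le ?_ (continuous_fst.comp continuous_snd)
  have hb : ∀ b, Continuous fun y : X × (ℝ × (Bool → WeakDual ℝ C(K, ℝ))) => y.2.2 b (e γ) :=
    fun b => (WeakDual.eval_continuous (e γ)).comp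
      ((continuous_apply b).comp (continuous_snd.comp continuous_snd))
  exact (((hl γ).comp continuous_fst).sub ((hb true).sub (hb false))).abs

lemma transferRel_add {x y : X} {z z' : ℝ × (Bool → WeakDual ℝ C(K, ℝ))}
    (h : (x, z) ∈ transferRel l e) (h' : (y, z') ∈ transferRel l e) :
    (x + y, z + z') ∈ transferRel l e := by
  intro γ
  refine le_trans ?_ (add_le_add (h γ) (h' γ))
  refine le_trans (le_of_eq ?_) (abs_add_le _ _)
  show |l γ (x + y) - ((z.2 true (e γ) + z'.2 true (e γ)) -
    (z.2 false (e γ) + z'.2 false (e γ)))| = _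
  rw [map_add]
  congr 1
  ring

lemma transferRel_smul {x : X} {z : ℝ × (Bool → WeakDual ℝ C(K, ℝ))} {c : ℝ} (hc : 0 ≤ c)
    (h : (x, z) ∈ transferRel l e) : (c • x, c • z) ∈ transferRel l e := by
  intro γ
  show |l γ (c • x) - (c * z.2 true (e γ) - c * z.2 false (e γ))| ≤ c * z.1
  rw [map_smul, smul_eq_mul, ← mul_sub, ← mul_sub, abs_mul, abs_of_nonneg hc]
  exact mul_le_mul_of_nonneg_left (h γ) hc

lemma transferRel_swap {x : X} {z : ℝ × (Bool → WeakDual ℝ C(K, ℝ))}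
    (h : (x, z) ∈ transferRel l e) : (-x, (z.1, fun b => z.2 (!b))) ∈ transferRel l e := by
  intro γ
  show |l γ (-x) - (z.2 false (e γ) - z.2 true (e γ))| ≤ z.1
  rw [map_neg, ← abs_neg]
  refine le_trans (le_of_eq ?_) (h γ)
  congr 1
  ring

variable [CompactSpace K]

section

variable (h0 : ∀ i, 0 ∈ A i) (h1 : ∀ i, ∀ f ∈ A i, ∀ x, 0 ≤ f x ∧ f x ≤ 1) (hδ : 0 < δ)
include h0 h1 hδ

lemma costVec_nonneg (z : ℝ × (Bool → WeakDual ℝ C(K, ℝ))) (j : Bool × Option ι) :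
    0 ≤ costVec A δ z j := by
  rcases j with ⟨b, _ | i⟩
  · exact abs_nonneg _
  · exact mul_nonneg hδ.le (supOn_nonneg (h1 i) _ (h0 i))

lemma costVec_le (z : ℝ × (Bool → WeakDual ℝ C(K, ℝ))) (j : Bool × Option ι) :
    costVec A δ z j ≤ |z.1| + δ * ∑ b, ‖WeakDual.toStrongDual (z.2 b)‖ := by
  have hn : 0 ≤ ∑ b, ‖WeakDual.toStrongDual (z.2 b)‖ := Finset.sum_nonneg fun _ _ =>
    ContinuousLinearMap.opNorm_nonneg _
  rcases j with ⟨b, _ | i⟩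
  · exact le_add_of_nonneg_right (mul_nonneg hδ.le hn)
  · have h2 := (supOn_le_norm (h1 i) (z.2 b) (h0 i)).trans
      (Finset.single_le_sum (f := fun b => ‖WeakDual.toStrongDual (z.2 b)‖)
        (fun _ _ => ContinuousLinearMap.opNorm_nonneg _) (Finset.mem_univ b))
    exact (mul_le_mul_of_nonneg_left h2 hδ.le).trans (le_add_of_nonneg_left (abs_nonneg _))

lemma costVec_add_le (z z' : ℝ × (Bool → WeakDual ℝ C(K, ℝ))) (j : Bool × Option ι) :
    costVec A δ (z + z') j ≤ costVec A δ z j + costVec A δ z' j := by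
  rcases j with ⟨b, _ | i⟩
  · exact abs_add_le _ _
  · show δ * _ ≤ δ * _ + δ * _
    rw [← mul_add]
    exact mul_le_mul_of_nonneg_left (supOn_add_le (h1 i) _ _ (h0 i)) hδ.le

variable (hw : ∀ o, 0 < w o) (hs : Summable w)
include hw hs

lemma summable_costVec (z : ℝ × (Bool → WeakDual ℝ C(K, ℝ))) :
    Summable fun j : Bool × Option ι => w j.2 * costVec A δ z j ^ 2 :=
  summable_l2_of_le (fun j => (hw j.2).le) (summable_comp_snd (fun o => (hw o).le) hs)
    (costVec_nonneg h0 h1 hδ z) (costVec_le h0 h1 hδ z)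

lemma transferCost_add_le (z z' : ℝ × (Bool → WeakDual ℝ C(K, ℝ))) :
    transferCost w A δ (z + z') ≤ transferCost w A δ z + transferCost w A δ z' :=
  l2Comb_le_add (fun j => (hw j.2).le) (costVec_nonneg h0 h1 hδ _) (costVec_add_le h0 h1 hδ z z')
    (summable_costVec h0 h1 hδ hw hs z) (summable_costVec h0 h1 hδ hw hs z')

lemma lowerSemicontinuous_transferCost : LowerSemicontinuous (transferCost w A δ) := by
  refine lowerSemicontinuous_l2Comb (φ := fun j z => costVec A δ z j) (fun j => (hw j.2).le) ?_
    (fun j z => costVec_nonneg h0 h1 hδ z j) (summable_costVec h0 h1 hδ hw hs)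
  rintro ⟨b, _ | i⟩
  · exact (continuous_abs.comp continuous_fst).lowerSemicontinuous
  · have hl : LowerSemicontinuous fun z : ℝ × (Bool → WeakDual ℝ C(K, ℝ)) => supOn (A i) (z.2 b) :=
      fun z y hy => (((continuous_apply b).comp continuous_snd).tendsto z).eventually
        (lowerSemicontinuous_supOn (h1 i) _ y hy)
    exact (continuous_const_mul δ).comp_lowerSemicontinuous hl
      fun u v huv => mul_le_mul_of_nonneg_left huv hδ.le

lemma sqrt_mul_abs_le_transferCost (z : ℝ × (Bool → WeakDual ℝ C(K, ℝ))) :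
    √(w none) * |z.1| ≤ transferCost w A δ z :=
  sqrt_weight_mul_le_l2Comb (fun j => (hw j.2).le) (summable_costVec h0 h1 hδ hw hs z)
    ((true, none) : Bool × Option ι)

lemma sqrt_mul_supOn_le_transferCost (z : ℝ × (Bool → WeakDual ℝ C(K, ℝ))) (b : Bool) (i : ι) :
    √(w (some i)) * (δ * supOn (A i) (z.2 b)) ≤ transferCost w A δ z :=
  sqrt_weight_mul_le_l2Comb (fun j => (hw j.2).le) (summable_costVec h0 h1 hδ hw hs z)
    ((b, some i) : Bool × Option ι)

/-- The cost bounds the error and, through the test function 1, the norms of positive functionals.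
Banach–Alaoglu gives a compact product containing the sublevel set, which is closed by lower
semicontinuity. -/
lemma isCompact_transferCost_le (hone : ∃ i, 1 ∈ A i) (r : ℝ) :
    IsCompact {z : ℝ × (Bool → WeakDual ℝ C(K, ℝ)) |
      z ∈ {z | ∀ b, IsPositiveFunctional (z.2 b)} ∧ transferCost w A δ z ≤ r} := by
  obtain ⟨i, hi⟩ := hone
  have hn : 0 < √(w none) := Real.sqrt_pos.2 (hw _)
  have hi' : 0 < √(w (some i)) * δ := mul_pos (Real.sqrt_pos.2 (hw _)) hδ
  have hcomp : IsCompact ((Metric.closedBall (0 : ℝ) (r / √(w none))) ×ˢ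
      (univ.pi fun _ : Bool => WeakDual.toStrongDual ⁻¹'
        Metric.closedBall (0 : StrongDual ℝ C(K, ℝ)) (r / (√(w (some i)) * δ)))) :=
    (isCompact_closedBall _ _).prod (isCompact_univ_pi fun _ => WeakDual.isCompact_closedBall _ _)
  refine hcomp.of_isClosed_subset ?_ ?_
  · have hpos : IsClosed {z : ℝ × (Bool → WeakDual ℝ C(K, ℝ)) |
        ∀ b, IsPositiveFunctional (z.2 b)} := by
      simp only [ofPred_forall]
      refine isClosed_iInter fun b => ?_
      have hb : Continuous fun z : ℝ × (Bool → WeakDual ℝ C(K, ℝ)) => z.2 b :=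
        (continuous_apply b).comp continuous_snd
      exact isClosed_isPositiveFunctional.preimage hb
    exact hpos.inter (lowerSemicontinuous_iff_isClosed_preimage.1
      (lowerSemicontinuous_transferCost h0 h1 hδ hw hs) r)
  · rintro z ⟨hz, hzr⟩
    refine ⟨?_, fun b _ => ?_⟩
    · rw [mem_closedBall_zero_iff, Real.norm_eq_abs, le_div_iff₀ hn, mul_comm]
      exact (sqrt_mul_abs_le_transferCost h0 h1 hδ hw hs z).trans hzr
    · refine (mem_closedBall_zero_iff (E := StrongDual ℝ C(K, ℝ))).2 ?_
      rw [le_div_iff₀ hi', mul_comm, mul_assoc]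
      refine le_trans ?_ ((sqrt_mul_supOn_le_transferCost h0 h1 hδ hw hs z b i).trans hzr)
      gcongr
      exact (hz b).norm_le.trans (le_supOn (h1 i) _ hi)

end

/-- The seminorm measuring the cost of representing a vector by a pair of positive functionals. -/
lemma exists_transfer_seminorm [TopologicalSpace X] (h0 : ∀ i, 0 ∈ A i)
    (h1 : ∀ i, ∀ f ∈ A i, ∀ x, 0 ≤ f x ∧ f x ≤ 1) (hδ : 0 < δ) (hw : ∀ o, 0 < w o)
    (hs : Summable w) (hone : ∃ i, 1 ∈ A i) (hl : ∀ γ, Continuous (l γ)) (t : Seminorm ℝ X)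
    (ht : ∀ γ x, |l γ x| ≤ t x) :
    ∃ p : Seminorm ℝ X, LowerSemicontinuous p ∧
      (∀ x z, (∀ b, IsPositiveFunctional (z.2 b)) → (x, z) ∈ transferRel l e →
        p x ≤ transferCost w A δ z) ∧
      ∀ x, ∃ z, (∀ b, IsPositiveFunctional (z.2 b)) ∧ (x, z) ∈ transferRel l e ∧
        transferCost w A δ z = p x := by
  set P : Set (ℝ × (Bool → WeakDual ℝ C(K, ℝ))) := {z | ∀ b, IsPositiveFunctional (z.2 b)} with hP
  have hc0 : ∀ z, 0 ≤ transferCost w A δ z := fun z => l2Comb_nonneg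
  have hlsc := lowerSemicontinuous_transferCost h0 h1 hδ hw hs
  have hR : IsClosed (transferRel l e) := isClosed_transferRel hl
  have hcomp := isCompact_transferCost_le h0 h1 hδ hw hs hone
  -- The zero functionals with error t x are always admissible.
  have hne : ∀ x, ∃ z ∈ P, (x, z) ∈ transferRel l e := fun x =>
    ⟨(t x, 0), fun _ _ _ => le_rfl, fun γ => by
      show |l γ x - (0 - 0)| ≤ t x
      simpa using ht γ x⟩
  set q := fibreInf (transferCost w A δ) (transferRel l e) P with hq
  have hle : ∀ x z, z ∈ P → (x, z) ∈ transferRel l e → q x ≤ transferCost w A δ z :=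
    fun x z hz hzR => fibreInf_le hc0 hz hzR
  have hmin : ∀ x, ∃ z ∈ P, (x, z) ∈ transferRel l e ∧ transferCost w A δ z = q x := fun x =>
    exists_fibreInf_eq hlsc hc0 hR hcomp (hne x)
  have hpos : ∀ (c : ℝ) (x : X), 0 ≤ c → q (c • x) ≤ c * q x := by
    intro c x hc
    obtain ⟨z, hz, hzR, hzq⟩ := hmin x
    rw [← hzq, ← transferCost_smul hc]
    exact hle _ _ (fun b f hf => mul_nonneg hc (hz b f hf)) (transferRel_smul hc hzR)
  -- Positive functionals only form a cone, so negation is realized by exchanging the two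
  -- functionals.
  have hneg : ∀ x, q (-x) ≤ q x := by
    intro x
    obtain ⟨z, hz, hzR, hzq⟩ := hmin x
    rw [← hzq, ← transferCost_swap]
    exact hle _ _ (fun b => hz (!b)) (transferRel_swap hzR)
  refine ⟨Seminorm.ofSMulLE q ?_ ?_ ?_, lowerSemicontinuous_fibreInf hlsc hc0 hR hcomp hne,
    hle, hmin⟩
  · refine le_antisymm ?_ ?_
    · simpa using hpos 0 0 le_rfl
    · obtain ⟨z, _, _, hzq⟩ := hmin 0
      exact hzq ▸ hc0 z
  · intro x y
    obtain ⟨z, hz, hzR, hzq⟩ := hmin x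
    obtain ⟨z', hz', hzR', hzq'⟩ := hmin y
    rw [← hzq, ← hzq']
    refine (hle _ _ (fun b f hf => ?_) (transferRel_add hzR hzR')).trans
      (transferCost_add_le h0 h1 hδ hw hs z z')
    exact add_nonneg (hz b f hf) (hz' b f hf)
  · intro c x
    rcases le_total 0 c with hc | hc
    · rw [Real.norm_of_nonneg hc]
      exact hpos c x hc
    · rw [Real.norm_of_nonpos hc]
      have := (hneg _).trans (hpos (-c) x (neg_nonneg.2 hc))
      simpa using this

/-- Countably many lower semicontinuous seminorms that are jointly strictly convex on the vectors
that can be approximated by differences of positive functionals. -/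
theorem exists_transfer_seminorms [TopologicalSpace X] [Countable ι] (h0 : ∀ i, 0 ∈ A i)
    (h1 : ∀ i, ∀ f ∈ A i, ∀ x, 0 ≤ f x ∧ f x ≤ 1) (hone : ∃ i, 1 ∈ A i)
    (hA : ∀ Λ Λ' : WeakDual ℝ C(K, ℝ), IsPositiveFunctional Λ → IsPositiveFunctional Λ' →
      (∀ i, supOn (A i) Λ = supOn (A i) Λ') →
      (∀ i, supOn (A i) (Λ + Λ') = supOn (A i) Λ + supOn (A i) Λ') → Λ = Λ')
    (hl : ∀ γ, Continuous (l γ)) (t : Seminorm ℝ X) (ht : ∀ γ x, |l γ x| ≤ t x) :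
    ∃ (p : ℕ → Seminorm ℝ X) (C : ℝ), (∀ n x, p n x ≤ C * t x) ∧
      (∀ n, LowerSemicontinuous (p n)) ∧
      ∀ x y, (∀ ε > 0, ∃ Λ : Bool → WeakDual ℝ C(K, ℝ), (∀ b, IsPositiveFunctional (Λ b)) ∧
          (x, (ε, Λ)) ∈ transferRel l e) →
        (∀ n, p n x = p n y ∧ p n (x + y) = p n x + p n y) → ∀ γ, l γ x = l γ y := by
  have := Encodable.ofCountable (Option ι)
  obtain ⟨w, hw, _, hws, _⟩ := posSumOfEncodable one_pos (Option ι)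
  have hs : Summable w := hws.summable
  -- As n grows the functionals become cheap and the error dominates the cost.
  have hδ : ∀ n : ℕ, (0 : ℝ) < 1 / (n + 1) := fun n => by positivity
  choose p hlsc hle hmin using fun n =>
    exists_transfer_seminorm (e := e) h0 h1 (hδ n) hw hs hone hl t ht
  set C := l2Comb (fun j : Bool × Option ι => w j.2) fun _ => 1 with hC
  have hw' : ∀ j : Bool × Option ι, 0 ≤ w j.2 := fun j => (hw j.2).le
  have hs' : Summable fun j : Bool × Option ι => w j.2 := summable_comp_snd (fun o => (hw o).le) hs
  have hconst : ∀ r : ℝ, 0 ≤ r → l2Comb (fun j : Bool × Option ι => w j.2) (fun _ => r) = r * C := by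
    intro r hr
    have := l2Comb_const_mul (w := fun j : Bool × Option ι => w j.2) (a := fun _ => 1) r
    simpa [abs_of_nonneg hr] using this
  -- the cost of an approximation, split into the error and the size of the functionals
  have hcost : ∀ Λ : Bool → WeakDual ℝ C(K, ℝ), ∃ M, 0 ≤ M ∧ ∀ (n : ℕ) (r : ℝ), 0 ≤ r →
      transferCost w A (1 / (n + 1 : ℝ)) (r, Λ) ≤ r * C + 1 / (n + 1) * M := by
    intro Λ
    refine ⟨transferCost w A 1 (0, Λ), l2Comb_nonneg, fun n r hr => ?_⟩
    rw [← hconst r hr, transferCost, transferCost, ← abs_of_pos (hδ n), ← l2Comb_const_mul,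
      abs_of_pos (hδ n)]
    refine l2Comb_le_add hw' (costVec_nonneg h0 h1 (hδ n) _) ?_
      (by simpa using hs'.mul_right (r ^ 2)) ?_
    · rintro ⟨b, _ | i⟩
      · show |r| ≤ r + 1 / (n + 1) * |(0 : ℝ)|
        simp [abs_of_nonneg hr]
      · show 1 / (n + 1 : ℝ) * supOn (A i) (Λ b) ≤ r + 1 / (n + 1) * (1 * supOn (A i) (Λ b))
        rw [one_mul]
        exact le_add_of_nonneg_left hr
    · exact ((summable_costVec h0 h1 one_pos hw hs (0, Λ)).mul_left ((1 / (n + 1 : ℝ)) ^ 2)).congr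
        fun j => by ring
  refine ⟨p, C, fun n x => ?_, hlsc, ?_⟩
  · refine (hle n x (t x, 0) (fun _ _ _ => le_rfl) fun γ => ?_).trans ?_
    · show |l γ x - (0 - 0)| ≤ t x
      simpa using ht γ x
    · rw [transferCost, mul_comm, ← hconst _ (apply_nonneg t x)]
      refine l2Comb_mono hw' (costVec_nonneg h0 h1 (hδ n) _) ?_
        (by simpa using hs'.mul_right (t x ^ 2))
      rintro ⟨b, _ | i⟩
      · exact (abs_of_nonneg (apply_nonneg t x)).le
      · have : supOn (A i) (0 : WeakDual ℝ C(K, ℝ)) = 0 := by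
          simpa using supOn_smul (A := A i) le_rfl (0 : WeakDual ℝ C(K, ℝ))
        show 1 / (n + 1 : ℝ) * supOn (A i) 0 ≤ t x
        rw [this, mul_zero]
        exact apply_nonneg t x
  · intro x y hx hxy γ
    have hn : 0 < √(w none) := Real.sqrt_pos.2 (hw _)
    -- Equality in ℓ² makes the minimizers for x and y share both functionals and the absolute
    -- error; the common representation then costs each vector one error, whence the factor 2.
    have hbound : ∀ n, √(w none) * |l γ x - l γ y| ≤ 2 * p n x := by
      intro n
      obtain ⟨z, hz, hzR, hzp⟩ := hmin n x
      obtain ⟨z', hz', hzR', hzp'⟩ := hmin n y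
      have hsum := hle n (x + y) (z + z') (fun b f hf => add_nonneg (hz b f hf) (hz' b f hf))
        (transferRel_add hzR hzR')
      rw [(hxy n).2, ← hzp, ← hzp'] at hsum
      have heq := eq_of_l2Comb_eq (fun j : Bool × Option ι => hw j.2)
        (costVec_nonneg h0 h1 (hδ n) z) (costVec_nonneg h0 h1 (hδ n) z')
        (costVec_nonneg h0 h1 (hδ n) (z + z')) (costVec_add_le h0 h1 (hδ n) z z')
        (summable_costVec h0 h1 (hδ n) hw hs z) (summable_costVec h0 h1 (hδ n) hw hs z')
        (hzp.trans ((hxy n).1.trans hzp'.symm)) hsum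
      have hΛ : z.2 = z'.2 := funext fun b => hA _ _ (hz b) (hz' b)
        (fun i => mul_left_cancel₀ (hδ n).ne' (heq (b, some i)).1)
        (fun i => mul_left_cancel₀ (hδ n).ne' ((heq (b, some i)).2.trans (mul_add _ _ _).symm))
      have hzs : |z.1| = |z'.1| := (heq (true, none)).1
      have e1 := (hzR γ).trans (le_abs_self _)
      have e2 := (hzR' γ).trans (le_abs_self _)
      simp only at e1 e2
      rw [← hΛ, ← hzs] at e2
      have e3 : |l γ x - l γ y| ≤ 2 * |z.1| := by
        rw [abs_le] at *
        constructor <;> linarith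
      have e4 := sqrt_mul_abs_le_transferCost h0 h1 (hδ n) hw hs z
      rw [hzp] at e4
      nlinarith
    have hCnn : 0 ≤ C := l2Comb_nonneg
    have hzero : √(w none) * |l γ x - l γ y| ≤ 0 := by
      refine le_of_forall_pos_le_add fun ε hε => ?_
      -- The error is fixed first, then functionals of some size M, and only then n. Each of the two
      -- parts of the cost is at most ε/4, so twice the cost is at most ε.
      obtain ⟨Λ, hΛ, hΛR⟩ := hx (ε / (4 * (C + 1))) (by positivity)
      obtain ⟨M, hM, hMle⟩ := hcost Λ
      obtain ⟨n, hn⟩ := exists_nat_one_div_lt (show 0 < ε / (4 * (M + 1)) by positivity)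
      have h2 := (hle n _ _ hΛ hΛR).trans (hMle n _ (by positivity))
      have h3 : ε / (4 * (C + 1)) * C ≤ ε / 4 := by
        rw [div_mul_eq_mul_div, div_le_div_iff₀ (by positivity) (by positivity)]
        nlinarith
      have h4 : 1 / (n + 1 : ℝ) * M ≤ ε / 4 := by
        refine (mul_le_mul_of_nonneg_right hn.le hM).trans ?_
        rw [div_mul_eq_mul_div, div_le_div_iff₀ (by positivity) (by positivity)]
        nlinarith
      linarith [hbound n]
    have := nonpos_of_mul_nonpos_right hzero hn
    exact sub_eq_zero.1 (abs_eq_zero.1 (le_antisymm this (abs_nonneg _)))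

end Transfer

/-! ### Seminorms from a Gruenhage compact set with dense span -/

section Gruenhage

variable {X : Type*} [AddCommGroup X] [Module ℝ X]

/-- The evaluation functional at a point of `K`. -/
noncomputable def diracFunctional {K : Type*} [TopologicalSpace K] (k : K) :
    WeakDual ℝ C(K, ℝ) :=
  StrongDual.toWeakDual (ContinuousMap.evalCLM ℝ k)

/-- Vectors in the span of `K` are represented by differences of positive functionals. -/
lemma exists_functionals_of_mem_span [TopologicalSpace X] {K : Set X} {Γ : Type*}
    {l : Γ → X →ₗ[ℝ] ℝ} {e : Γ → C(K, ℝ)} (he : ∀ γ k, e γ k = l γ k) {y : X}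
    (hy : y ∈ Submodule.span ℝ K) :
    ∃ Λ : Bool → WeakDual ℝ C(K, ℝ), (∀ b, IsPositiveFunctional (Λ b)) ∧
      ∀ γ, l γ y = Λ true (e γ) - Λ false (e γ) := by
  induction hy using Submodule.span_induction with
  | mem k hk =>
    refine ⟨fun b => bif b then diracFunctional ⟨k, hk⟩ else 0, ?_, fun γ => ?_⟩
    · rintro (_ | _) f hf
      exacts [le_rfl, hf ⟨k, hk⟩]
    · show l γ k = e γ ⟨k, hk⟩ - 0
      rw [sub_zero, he]
  | zero => exact ⟨0, fun _ _ _ => le_rfl, fun γ => by show l γ 0 = 0 - 0; simp⟩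
  | add x y _ _ hx hy =>
    obtain ⟨Λ, hΛ, hx⟩ := hx
    obtain ⟨Λ', hΛ', hy⟩ := hy
    refine ⟨Λ + Λ', fun b f hf => add_nonneg (hΛ b f hf) (hΛ' b f hf), fun γ => ?_⟩
    show l γ (x + y) = (Λ true (e γ) + Λ' true (e γ)) - (Λ false (e γ) + Λ' false (e γ))
    rw [map_add, hx, hy]
    ring
  | smul a x _ hx =>
    obtain ⟨Λ, hΛ, hx⟩ := hx
    rcases le_total 0 a with ha | ha
    · refine ⟨a • Λ, fun b f hf => mul_nonneg ha (hΛ b f hf), fun γ => ?_⟩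
      show l γ (a • x) = a * Λ true (e γ) - a * Λ false (e γ)
      rw [map_smul, hx, smul_eq_mul, mul_sub]
    -- A negative scalar exchanges the two functionals, keeping both positive.
    · refine ⟨fun b => (-a) • Λ (!b), fun b f hf => mul_nonneg (neg_nonneg.2 ha) (hΛ _ f hf),
        fun γ => ?_⟩
      show l γ (a • x) = (-a) * Λ false (e γ) - (-a) * Λ true (e γ)
      rw [map_smul, hx, smul_eq_mul]
      ring

/-- If the span of a Gruenhage compact set is dense for a seminorm dominating a separating family of
continuous functionals, then countably many lower semicontinuous seminorms are jointly strictly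
convex. -/
theorem exists_seminorms_of_isGruenhageCompact [TopologicalSpace X] {K : Set X}
    (hK : IsGruenhageCompact K) {Γ : Type*} {l : Γ → X →ₗ[ℝ] ℝ} (hl : ∀ γ, Continuous (l γ))
    (hsep : ∀ x y, x ≠ y → ∃ γ, l γ x ≠ l γ y) (t : Seminorm ℝ X) (ht : ∀ γ x, |l γ x| ≤ t x)
    (hspan : ∀ x, ∀ ε > 0, ∃ y ∈ Submodule.span ℝ K, t (x - y) < ε) :
    ∃ (p : ℕ → Seminorm ℝ X) (C : ℝ), (∀ n x, p n x ≤ C * t x) ∧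
      (∀ n, LowerSemicontinuous (p n)) ∧
      ∀ x y, (∀ n, p n x = p n y ∧ p n (x + y) = p n x + p n y) → x = y := by
  have : T2Space X := T2Space.of_injective_continuous (f := fun x γ => l γ x)
    (fun x y hxy => by
      by_contra hne
      obtain ⟨γ, hγ⟩ := hsep x y hne
      exact hγ (congrFun hxy γ)) (continuous_pi hl)
  have : CompactSpace K := isCompact_iff_compactSpace.1 hK.1
  obtain ⟨ι, _, A, h0, h1, hone, hA⟩ := exists_testSets_of_isGruenhageSpace hK.2
  let e : Γ → C(K, ℝ) := fun γ => ⟨fun k => l γ k, (hl γ).comp continuous_subtype_val⟩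
  let lin : WeakDual ℝ C(K, ℝ) → C(K, ℝ) →ₗ[ℝ] ℝ := fun Λ => (WeakDual.toStrongDual Λ).toLinearMap
  obtain ⟨p, C, hpC, hlsc, hp⟩ := exists_transfer_seminorms (e := e) h0 h1 hone
    (fun Λ Λ' hΛ hΛ' h h' => by
      have := hA (lin Λ) (lin Λ') hΛ hΛ' h h'
      exact DFunLike.ext _ _ fun f => LinearMap.congr_fun this f) hl t ht
  refine ⟨p, C, hpC, hlsc, fun x y hxy => ?_⟩
  by_contra hne
  obtain ⟨γ, hγ⟩ := hsep x y hne
  refine hγ (hp x y (fun ε hε => ?_) hxy γ)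
  obtain ⟨z, hz, hxz⟩ := hspan x ε hε
  obtain ⟨Λ, hΛ, hΛz⟩ := exists_functionals_of_mem_span (e := e) (fun _ _ => rfl) hz
  refine ⟨Λ, hΛ, fun γ => ?_⟩
  show |l γ x - (Λ true (e γ) - Λ false (e γ))| ≤ ε
  rw [← hΛz, ← map_sub]
  exact (ht γ _).trans hxz.le

end Gruenhage

/-! ### Combining seminorms into one -/

section Combination

variable {ι : Type*} {X : Type*} [AddCommGroup X] [Module ℝ X] {w : ι → ℝ}

lemma l2Comb_le_mul (hw : ∀ i, 0 ≤ w i) (hs : Summable w) {a : ι → ℝ} (ha : ∀ i, 0 ≤ a i) {M : ℝ}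
    (hM : 0 ≤ M) (haM : ∀ i, a i ≤ M) : l2Comb w a ≤ M * l2Comb w fun _ => 1 := by
  have h := l2Comb_const_mul (w := w) (a := fun _ => 1) M
  rw [abs_of_nonneg hM] at h
  rw [← h]
  exact l2Comb_mono hw ha (by simpa using haM) (by simpa using hs.mul_right (M ^ 2))

lemma l2Seminorm_eq_of_eq (hw : ∀ i, 0 < w i) (hs : Summable w) {q : ι → Seminorm ℝ X}
    (hq : ∀ x, ∃ C, ∀ i, q i x ≤ C) {x y : X}
    (hxy : l2Seminorm w (fun i => (hw i).le) hs q hq x =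
      l2Seminorm w (fun i => (hw i).le) hs q hq y)
    (hadd : l2Seminorm w (fun i => (hw i).le) hs q hq y =
      1 / 2 * l2Seminorm w (fun i => (hw i).le) hs q hq (x + y)) (i : ι) :
    q i x = q i y ∧ q i (x + y) = q i x + q i y := by
  have hsum : ∀ x, Summable fun i => w i * q i x ^ 2 := fun x =>
    summable_l2_of_le (fun i => (hw i).le) hs (fun i => apply_nonneg (q i) x) (hq x).choose_spec
  refine eq_of_l2Comb_eq (a := fun i => q i x) (b := fun i => q i y) (c := fun i => q i (x + y)) hw
    (fun i => apply_nonneg _ _) (fun i => apply_nonneg _ _) (fun i => apply_nonneg _ _)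
    (fun i => map_add_le_add (q i) x y) (hsum x) (hsum y) hxy ?_ i
  change l2Comb w (fun i => q i x) = l2Comb w fun i => q i y at hxy
  change l2Comb w (fun i => q i y) = 1 / 2 * l2Comb w fun i => q i (x + y) at hadd
  linarith

lemma sqrt_weight_mul_le_l2Seminorm (hw : ∀ i, 0 ≤ w i) (hs : Summable w) {q : ι → Seminorm ℝ X}
    (hq : ∀ x, ∃ C, ∀ i, q i x ≤ C) (x : X) (i : ι) :
    √(w i) * q i x ≤ l2Seminorm w hw hs q hq x :=
  sqrt_weight_mul_le_l2Comb (a := fun i => q i x) hw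
    (summable_l2_of_le hw hs (fun i => apply_nonneg (q i) x) (hq x).choose_spec) i

end Combination

/-! ### The supremum over the unit ball of `F` -/

section NormingSeminorm

variable {X : Type*} [NormedAddCommGroup X] [NormedSpace ℝ X]
  (F : Submodule ℝ (StrongDual ℝ X))

lemma apply_le_norm_of_norm_le_one {f : StrongDual ℝ X} (hf : ‖f‖ ≤ 1) (x : X) : f x ≤ ‖x‖ :=
  (le_abs_self _).trans ((f.le_opNorm x).trans (mul_le_of_le_one_left (norm_nonneg x) hf))

lemma bddAbove_unitBall_values (x : X) : BddAbove {r : ℝ | ∃ f ∈ F, ‖f‖ ≤ 1 ∧ r = f x} :=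
  ⟨‖x‖, by rintro _ ⟨f, _, hf, rfl⟩; exact apply_le_norm_of_norm_le_one hf x⟩

lemma nonempty_unitBall_values (x : X) : {r : ℝ | ∃ f ∈ F, ‖f‖ ≤ 1 ∧ r = f x}.Nonempty :=
  ⟨0, 0, F.zero_mem, by simp, by simp⟩

/-- The supremum over the unit ball of a subspace of the dual. -/
noncomputable def unitBallSeminorm : Seminorm ℝ X :=
  Seminorm.ofSMulLE (fun x => sSup {r : ℝ | ∃ f ∈ F, ‖f‖ ≤ 1 ∧ r = f x})
    (le_antisymm (csSup_le (nonempty_unitBall_values F 0)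
        (by rintro _ ⟨f, _, _, rfl⟩; simp))
      (le_csSup (bddAbove_unitBall_values F 0) ⟨0, F.zero_mem, by simp, by simp⟩))
    (fun x y => csSup_le (nonempty_unitBall_values F _) (by
      rintro _ ⟨f, hf, hf1, rfl⟩
      rw [map_add]
      exact add_le_add (le_csSup (bddAbove_unitBall_values F x) ⟨f, hf, hf1, rfl⟩)
        (le_csSup (bddAbove_unitBall_values F y) ⟨f, hf, hf1, rfl⟩)))
    (fun c x => csSup_le (nonempty_unitBall_values F _) (by
      rintro _ ⟨f, hf, hf1, rfl⟩
      rw [map_smul, smul_eq_mul]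
      rcases le_total 0 c with hc | hc
      · rw [Real.norm_of_nonneg hc]
        exact mul_le_mul_of_nonneg_left
          (le_csSup (bddAbove_unitBall_values F x) ⟨f, hf, hf1, rfl⟩) hc
      · rw [Real.norm_of_nonpos hc, ← neg_mul_neg]
        exact mul_le_mul_of_nonneg_left (le_csSup (bddAbove_unitBall_values F x)
          ⟨-f, F.neg_mem hf, by rwa [norm_neg], by simp⟩) (neg_nonneg.2 hc)))

lemma unitBallSeminorm_apply (x : X) :
    unitBallSeminorm F x = sSup {r : ℝ | ∃ f ∈ F, ‖f‖ ≤ 1 ∧ r = f x} := rfl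

lemma unitBallSeminorm_le (x : X) : unitBallSeminorm F x ≤ ‖x‖ :=
  csSup_le (nonempty_unitBall_values F x)
    (by rintro _ ⟨f, _, hf, rfl⟩; exact apply_le_norm_of_norm_le_one hf x)

lemma apply_le_norm_mul_unitBallSeminorm {f : StrongDual ℝ X} (hf : f ∈ F) (x : X) :
    f x ≤ ‖f‖ * unitBallSeminorm F x := by
  rcases eq_or_ne f 0 with rfl | hf0
  · simp
  · have hn : 0 < ‖f‖ := norm_pos_iff.2 hf0
    have h : ‖f‖⁻¹ * f x ≤ unitBallSeminorm F x := by
      refine le_csSup (bddAbove_unitBall_values F x)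
        ⟨‖f‖⁻¹ • f, F.smul_mem _ hf, ?_, by simp⟩
      rw [norm_smul, norm_inv, norm_norm, inv_mul_cancel₀ hn.ne']
    rwa [inv_mul_le_iff₀ hn] at h

lemma continuous_sigmaTopology {f : StrongDual ℝ X} (hf : f ∈ F) :
    @Continuous X ℝ (sigmaTopology F) _ f :=
  WeakBilin.eval_continuous (evalPairing F) ⟨f, hf⟩

lemma lowerSemicontinuous_unitBallSeminorm :
    @LowerSemicontinuous X ℝ (sigmaTopology F) _ (unitBallSeminorm F) := by
  have : (unitBallSeminorm F : X → ℝ) =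
      fun x => ⨆ f : {f : StrongDual ℝ X // f ∈ F ∧ ‖f‖ ≤ 1}, f.1 x := by
    funext x
    rw [unitBallSeminorm_apply, iSup]
    congr 1
    ext r
    constructor
    · rintro ⟨f, hf, hf1, rfl⟩
      exact ⟨⟨f, hf, hf1⟩, rfl⟩
    · rintro ⟨⟨f, hf, hf1⟩, rfl⟩
      exact ⟨f, hf, hf1, rfl⟩
  rw [this]
  refine @lowerSemicontinuous_ciSup X (sigmaTopology F) _ _ _ _ (fun x => ?_) fun f =>
    @Continuous.lowerSemicontinuous X (sigmaTopology F) _ _ _ _ _ (continuous_sigmaTopology F f.2.1)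
  exact ⟨‖x‖, by rintro _ ⟨f, rfl⟩; exact apply_le_norm_of_norm_le_one f.2.2 x⟩

end NormingSeminorm

/-! ### The two renormings -/

theorem proposition2p8 {X : Type*} [NormedAddCommGroup X] [NormedSpace ℝ X] [CompleteSpace X]
    (F : Submodule ℝ (StrongDual ℝ X)) (t : Seminorm ℝ X)
    (ht_norm : IsNorm t) (ht_coarser : IsCoarserThanNorm t)
    (hF : SeparatesWithBounded F t)
    (K : Set X) (hK : @IsGruenhageCompact X (sigmaTopology F) K)
    (hspan : IsClosedSpan t K) :
    (∃ p : Seminorm ℝ X, IsNorm p ∧ IsCoarserThanNorm p ∧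
      @LowerSemicontinuous X ℝ (sigmaTopology F) _ p ∧ IsStrictlyConvexNorm p ∧
      (IsNormingSubspace F → IsEquivalentToNorm p)) ∧
    (∃ q : Seminorm ℝ X, IsEquivalentToNorm q ∧ IsStrictlyConvexNorm q) := by
  obtain ⟨D, hD⟩ := ht_coarser
  -- Normalizing the bound to 1 keeps the family separating, since bounded functionals can be
  -- rescaled, and makes the approximation error uniform.
  let Γ := {f : StrongDual ℝ X // f ∈ F ∧ ∀ z, |f z| ≤ t z}
  have hsep : ∀ x y : X, x ≠ y → ∃ γ : Γ, γ.1.toLinearMap x ≠ γ.1.toLinearMap y := by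
    intro x y hxy
    obtain ⟨f, hf, ⟨C, hC⟩, hfxy⟩ := hF x y hxy
    have hpos : 0 < |C| + 1 := by positivity
    refine ⟨⟨(|C| + 1)⁻¹ • f, F.smul_mem _ hf, fun z => ?_⟩, fun h => hfxy ?_⟩
    · rw [smul_apply, smul_eq_mul, abs_mul, abs_of_pos (inv_pos.2 hpos),
        inv_mul_le_iff₀ hpos]
      refine (hC z).trans (mul_le_mul_of_nonneg_right ?_ (apply_nonneg t z))
      linarith [le_abs_self C]
    · exact mul_left_cancel₀ (inv_pos.2 hpos).ne' h
  obtain ⟨s, C, hsC, hslsc, hs⟩ := @exists_seminorms_of_isGruenhageCompact X _ _ (sigmaTopology F) K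
    hK Γ (fun γ => γ.1.toLinearMap) (fun γ => continuous_sigmaTopology F γ.2.1) hsep t
    (fun γ => γ.2.2) hspan
  -- The entry `none` makes the combination a norm, and an equivalent one when `F` is norming; the
  -- entries `s n` make it strictly convex.
  let q : Option ℕ → Seminorm ℝ X := fun o => o.elim (unitBallSeminorm F) s
  have hqB : ∀ o x, q o x ≤ (1 + |C| * |D|) * ‖x‖ := by
    have h0 : ∀ x : X, t x ≤ |D| * ‖x‖ := fun x =>
      (hD x).trans (mul_le_mul_of_nonneg_right (le_abs_self D) (norm_nonneg x))
    rintro (_ | n) x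
    · refine (unitBallSeminorm_le F x).trans (le_mul_of_one_le_left (norm_nonneg x) ?_)
      linarith [mul_nonneg (abs_nonneg C) (abs_nonneg D)]
    · refine (hsC n x).trans ?_
      have h1 := mul_le_mul_of_nonneg_right (le_abs_self C) (apply_nonneg t x)
      have h2 := mul_le_mul_of_nonneg_left (h0 x) (abs_nonneg C)
      nlinarith [norm_nonneg x]
  obtain ⟨w, hw, _, hws, _⟩ := posSumOfEncodable one_pos (Option ℕ)
  have hqC : ∀ x, ∃ C, ∀ o, q o x ≤ C := fun x => ⟨_, fun o => hqB o x⟩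
  set p := l2Seminorm w (fun o => (hw o).le) hws.summable q hqC with hp
  have hpF : ∀ x, √(w none) * unitBallSeminorm F x ≤ p x := fun x =>
    sqrt_weight_mul_le_l2Seminorm (fun o => (hw o).le) hws.summable hqC x none
  have hw0 : 0 < √(w none) := Real.sqrt_pos.2 (hw _)
  have hpB : ∀ x, p x ≤ (1 + |C| * |D|) * l2Comb w (fun _ => 1) * ‖x‖ := by
    intro x
    refine (l2Comb_le_mul (fun o => (hw o).le) hws.summable (fun o => apply_nonneg (q o) x)
      (by positivity) fun o => hqB o x).trans (le_of_eq (by ring))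
  have hpstrict : IsStrictlyConvexNorm p := fun x y h1 h2 =>
    hs x y fun n => l2Seminorm_eq_of_eq hw hws.summable hqC h1 h2 (some n)
  refine ⟨⟨p, fun x hx => ?_, ⟨_, hpB⟩, ?_, hpstrict, ?_⟩, ?_⟩
  · by_contra hne
    obtain ⟨f, hf, _, hfx⟩ := hF x 0 hne
    -- Vanishing of this seminorm annihilates x under all of `F`, which separates points.
    have h0 : unitBallSeminorm F x ≤ 0 := by
      have := hpF x
      rw [hx] at this
      exact nonpos_of_mul_nonpos_right this hw0
    have h1 := apply_le_norm_mul_unitBallSeminorm F hf x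
    have h2 := apply_le_norm_mul_unitBallSeminorm F (F.neg_mem hf) x
    have h3 := mul_nonpos_of_nonneg_of_nonpos (norm_nonneg f) h0
    rw [norm_neg, neg_apply] at h2
    rw [map_zero] at hfx
    exact hfx (by linarith)
  · refine @lowerSemicontinuous_l2Comb _ w X (sigmaTopology F) (fun o x => q o x)
      (fun o => (hw o).le) ?_ (fun o x => apply_nonneg (q o) x) fun x =>
        summable_l2_of_le (fun o => (hw o).le) hws.summable (fun o => apply_nonneg (q o) x)
          fun o => hqB o x
    rintro (_ | n)
    exacts [lowerSemicontinuous_unitBallSeminorm F, hslsc n]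
  · rintro ⟨c, hc, hcF⟩
    refine ⟨√(w none) * c, _, mul_pos hw0 hc, fun x => ⟨?_, hpB x⟩⟩
    rw [mul_assoc]
    exact (mul_le_mul_of_nonneg_left (hcF x) hw0.le).trans (hpF x)
  -- The entry `true` gives the lower bound by ‖·‖ with constant 1; the entry `false` passes on the
  -- strict convexity of p.
  · let r : Bool → Seminorm ℝ X := fun b => bif b then normSeminorm ℝ X else p
    set E := 1 + |(1 + |C| * |D|) * l2Comb w fun _ => 1| with hE
    have hrB : ∀ b x, r b x ≤ E * ‖x‖ := by
      rintro (_ | _) x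
      · refine (hpB x).trans (mul_le_mul_of_nonneg_right ?_ (norm_nonneg x))
        linarith [le_abs_self ((1 + |C| * |D|) * l2Comb w fun _ => 1)]
      · refine le_mul_of_one_le_left (norm_nonneg x) ?_
        linarith [abs_nonneg ((1 + |C| * |D|) * l2Comb w fun _ => 1)]
    have hrC : ∀ x, ∃ C, ∀ b, r b x ≤ C := fun x => ⟨_, fun b => hrB b x⟩
    have h1 : ∀ _ : Bool, (0 : ℝ) < 1 := fun _ => one_pos
    have hsum : Summable fun _ : Bool => (1 : ℝ) := .of_finite
    refine ⟨l2Seminorm _ (fun b => (h1 b).le) hsum r hrC, ⟨1, E * l2Comb (fun _ : Bool => 1) fun _ => 1,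
      one_pos, fun x => ⟨?_, ?_⟩⟩, fun x y hx hy => ?_⟩
    · have := sqrt_weight_mul_le_l2Seminorm (fun b => (h1 b).le) hsum hrC x true
      rwa [Real.sqrt_one] at this
    · refine (l2Comb_le_mul (fun b => (h1 b).le) hsum (fun b => apply_nonneg (r b) x)
        (by positivity) fun b => hrB b x).trans (le_of_eq (by ring))
    · obtain ⟨e1, e2⟩ := l2Seminorm_eq_of_eq h1 hsum hrC hx hy false
      change p x = p y at e1
      change p (x + y) = p x + p y at e2
      exact hpstrict x y e1 (by linarith)
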